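/- Let $\mathbb K$ be a field, $G$ an abelian group, $A=\bigoplus_{\gamma\in G}A_\gamma$ a $G$-graded $\mathbb K$-algebra and $A^e=A\otimes_{\mathbb K}A^{o}$ its enveloping algebra with the induced $G$-grading. Let $\mathrm{Mod}^G A^e$ be the abelian category of $G$-graded $A$-bimodules (graded left $A^e$-modules) with degree-preserving $A^e$-linear maps; for such a module $M$ and $\gamma\in G$ let $\Sigma_\gamma M$ be $M$ with the grading $(\Sigma_\gamma M)_\delta=M_{\gamma+\delta}$. For $d\ge 0$ put $$\underline{\mathrm{Ext}}^{d,G}_{A^e}(A,A^e)=\bigoplus_{\gamma\in G}\mathrm{Ext}^d_{\mathrm{Mod}^G A^e}(A,\Sigma_\gamma A^e),$$ a $G$-graded $A$-bimodule through the right multiplications of $A^e$ on itself: $a\cdot x\cdot b$ is the image of $x$ under right multiplication by $b\otimes a^{o}$. Let $\mathrm{Aut}_G(A)$ be the group of degree-preserving $\mathbb K$-algebra automorphisms of $A$, $U(A_0)$ the group of units of $A_0$, $Z(A)$ the center of $A$, and $c_\xi(a)=\xi a\xi^{-1}$ for $\xi\in U(A_0)$. For $\mu\in\mathrm{Aut}_G(A)$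 let ${}^1\!A^\mu$ be $A$ with its grading and the bimodule structure $a*m=am$, $m*a=m\,\mu(a)$. An element $z\in A$ is called $\sigma$-skew, for $\sigma\in \mathrm{Aut}_G(A)$, if $za=\sigma(a)z$ for all $a\in A$ and $\sigma(z)=z$; it is called regular if it is neither a left nor a right zero divisor, and normal if $zA=Az$. Let $d\ge 0$ be an integer and suppose that $\underline{\mathrm{Ext}}^{d,G}_{A^e}(A,A^e)\cong\Sigma_{\mathfrak l}{}^1\!A^\mu$ as $G$-graded $A$-bimodules for some $\mu\in\mathrm{Aut}_G(A)$ and $\mathfrak l\in G$. Then there is a map $\Xi:\mathrm{Aut}_G(A)\to U(A_0)$ such that 1. $\Xi(\sigma\circ\tau)=\Xi(\sigma)\cdot\sigma(\Xi(\tau))$ for all $\sigma,\tau\in\mathrm{Aut}_G(A)$; 2. $\mu\circ\sigma\circ\mu^{-1}\circ\sigma^{-1}=c_{\Xi(\sigma)}$ for every $\sigma\in\mathrm{Aut}_G(A)$; 3. $\mu(z)=\Xi(\sigma)\cdot z$ for every $\sigma\in\mathrm{Aut}_G(A)$ and every $\sigma$-skew element $z\in A$. Consequently, for every homogeneous regular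 normal element $z\in A$ there is $\xi\in U(A_0)$ with $\mu(z)=\xi z$; one has $\mu(z)=z$ for every central element $z\in A$; and $\mu$ lies in the center of $\mathrm{Aut}_G(A)$ whenever $U(A_0)\subseteq Z(A)$. -/

import Mathlib

open CategoryTheory CategoryTheory.Limits CategoryTheory.Abelian DirectSum TensorProduct

universe v v' uK uR uA uG

/-! ### Projections of a graded abelian group -/

section Projections

variable {G : Type*} [DecidableEq G] {M : Type*} [AddCommGroup M]

/-- The projection of `M = ⨁ deg γ` onto its component of degree `γ`. -/
noncomputable def gradedProj (deg : G → AddSubgroup M) (h : DirectSum.IsInternal deg) (γ : G) :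
    M →+ M :=
  ((deg γ).subtype.comp (DFinsupp.evalAddMonoidHom γ)).comp
    (AddEquiv.ofBijective (DirectSum.coeAddMonoidHom deg) h).symm.toAddMonoidHom

theorem gradedProj_mem (deg : G → AddSubgroup M) (h : DirectSum.IsInternal deg) (γ : G) (m : M) :
    gradedProj deg h γ m ∈ deg γ := by
  simp [gradedProj]

theorem gradedProj_coe (deg : G → AddSubgroup M) (h : DirectSum.IsInternal deg) (γ : G)
    (x : ⨁ i, deg i) :
    gradedProj deg h γ (DirectSum.coeAddMonoidHom deg x) = (x γ : M) := by
  have : (AddEquiv.ofBijective (DirectSum.coeAddMonoidHom deg) h).symm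
      (DirectSum.coeAddMonoidHom deg x) = x :=
    (AddEquiv.ofBijective (DirectSum.coeAddMonoidHom deg) h).symm_apply_apply x
  simp only [gradedProj, AddMonoidHom.comp_apply]
  erw [this]
  rfl

theorem gradedProj_same (deg : G → AddSubgroup M) (h : DirectSum.IsInternal deg) (γ : G) (m : M)
    (hm : m ∈ deg γ) : gradedProj deg h γ m = m := by
  have := gradedProj_coe deg h γ (DirectSum.of (fun i => deg i) γ ⟨m, hm⟩)
  simpa using this

theorem gradedProj_ne (deg : G → AddSubgroup M) (h : DirectSum.IsInternal deg) {γ δ : G} (m : M)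
    (hm : m ∈ deg γ) (hne : δ ≠ γ) : gradedProj deg h δ m = 0 := by
  have := gradedProj_coe deg h δ (DirectSum.of (fun i => deg i) γ ⟨m, hm⟩)
  rw [DirectSum.of_eq_of_ne _ _ _ hne] at this
  simpa using this

theorem graded_induction (deg : G → AddSubgroup M) (h : DirectSum.IsInternal deg)
    {p : M → Prop} (h0 : p 0) (hadd : ∀ x y, p x → p y → p (x + y))
    (hdeg : ∀ γ, ∀ m ∈ deg γ, p m) (m : M) : p m := by
  obtain ⟨x, rfl⟩ := h.2 m
  induction x using DirectSum.induction_on with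
  | zero => simpa using h0
  | of i x => simpa using hdeg i x x.2
  | add x y hx hy => rw [map_add]; exact hadd _ _ hx hy

theorem graded_sum_proj (deg : G → AddSubgroup M) (h : DirectSum.IsInternal deg) (m : M) :
    ∃ s : Finset G, m = ∑ γ ∈ s, gradedProj deg h γ m := by
  classical
  obtain ⟨x, rfl⟩ := h.2 m
  refine ⟨DFinsupp.support x, ?_⟩
  simp only [gradedProj_coe]
  rw [DirectSum.coeAddMonoidHom_eq_dfinsuppSum]
  rfl

/-- A criterion for a family of subgroups to be a grading. -/
theorem isInternal_of_proj (deg : G → AddSubgroup M) (p : G → M →+ M)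
    (hspan : ∀ m, m ∈ (⨆ γ, deg γ)) (hsame : ∀ γ, ∀ m ∈ deg γ, p γ m = m)
    (hne : ∀ γ δ, δ ≠ γ → ∀ m ∈ deg γ, p δ m = 0) : DirectSum.IsInternal deg := by
  have key : ∀ (γ : G) (x : ⨁ i, deg i),
      p γ (DirectSum.coeAddMonoidHom deg x) = (x γ : M) := by
    intro γ x
    induction x using DirectSum.induction_on with
    | zero => simp
    | of i x =>
      by_cases hi : γ = i
      · subst hi; simp [hsame γ x x.2]
      · rw [DirectSum.of_eq_of_ne _ _ _ hi]
        simp [hne i γ hi x x.2]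
    | add x y hx hy => simp [hx, hy]
  constructor
  · rw [injective_iff_map_eq_zero]
    intro x hx
    refine DFinsupp.ext fun γ => Subtype.ext ?_
    have := key γ x
    rw [hx, map_zero] at this
    exact this.symm
  · intro m
    have hle : (⨆ γ, deg γ) ≤ (DirectSum.coeAddMonoidHom deg).range := by
      refine iSup_le fun γ x hx => ⟨DirectSum.of (fun i => deg i) γ ⟨x, hx⟩, by simp⟩
    exact hle (hspan m)

end Projections

/-! ### The abelian category of graded modules -/

section GradedModules

variable {K : Type uK} [Field K] {R : Type uR} [Ring R] [Algebra K R]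
  {G : Type uG} [AddCommGroup G] [DecidableEq G]

/-- A `G`-graded left module over the `G`-graded algebra `R = ⨁ 𝓡 γ`. -/
structure GrMod (𝓡 : G → Submodule K R) where
  carrier : Type v
  [addCommGroup : AddCommGroup carrier]
  [module : Module R carrier]
  deg : G → AddSubgroup carrier
  isInternal : DirectSum.IsInternal deg
  smul_mem : ∀ (γ δ : G) (r : R) (m : carrier), r ∈ 𝓡 γ → m ∈ deg δ → r • m ∈ deg (γ + δ)

namespace GrMod

variable {𝓡 : G → Submodule K R}

attribute [instance] GrMod.addCommGroup GrMod.module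

/-- Morphisms of graded modules: linear maps that preserve degrees. -/
@[ext]
structure Hom (M N : GrMod.{v} 𝓡) where
  lin : M.carrier →ₗ[R] N.carrier
  map_deg : ∀ (γ : G) (m : M.carrier), m ∈ M.deg γ → lin m ∈ N.deg γ

instance : Category (GrMod.{v} 𝓡) where
  Hom M N := Hom M N
  id M := ⟨LinearMap.id, fun _ _ h => h⟩
  comp f g := ⟨g.lin.comp f.lin, fun γ m h => g.map_deg γ _ (f.map_deg γ m h)⟩

variable {M N P : GrMod.{v} 𝓡}

/-- The linear map underlying a morphism. -/
def linMap (f : M ⟶ N) : M.carrier →ₗ[R] N.carrier := Hom.lin f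

/-- A morphism from a linear map that preserves degrees. -/
def mkHom (f : M.carrier →ₗ[R] N.carrier) (hf : ∀ γ, ∀ m ∈ M.deg γ, f m ∈ N.deg γ) : M ⟶ N :=
  Hom.mk f hf

theorem linMap_mem (f : M ⟶ N) {γ : G} {m : M.carrier} (h : m ∈ M.deg γ) :
    linMap f m ∈ N.deg γ := Hom.map_deg f γ m h

theorem hom_ext' {f g : M ⟶ N} (h : linMap f = linMap g) : f = g := Hom.ext h

@[simp] theorem linMap_mkHom (f : M.carrier →ₗ[R] N.carrier)
    (hf : ∀ γ, ∀ m ∈ M.deg γ, f m ∈ N.deg γ) : linMap (mkHom f hf) = f := rfl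

@[simp] theorem linMap_id : linMap (𝟙 M) = LinearMap.id := rfl

@[simp] theorem linMap_comp (f : M ⟶ N) (g : N ⟶ P) :
    linMap (f ≫ g) = (linMap g).comp (linMap f) := rfl

instance : Zero (M ⟶ N) := ⟨mkHom 0 fun γ _ _ => (N.deg γ).zero_mem⟩
instance : Add (M ⟶ N) := ⟨fun f g => mkHom (linMap f + linMap g)
  fun γ _ h => (N.deg γ).add_mem (linMap_mem f h) (linMap_mem g h)⟩
instance : Neg (M ⟶ N) := ⟨fun f => mkHom (-linMap f)
  fun γ _ h => (N.deg γ).neg_mem (linMap_mem f h)⟩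
instance : Sub (M ⟶ N) := ⟨fun f g => mkHom (linMap f - linMap g)
  fun γ _ h => (N.deg γ).sub_mem (linMap_mem f h) (linMap_mem g h)⟩
instance : SMul ℕ (M ⟶ N) := ⟨fun n f => mkHom (n • linMap f)
  fun γ _ h => (N.deg γ).nsmul_mem (linMap_mem f h) n⟩
instance : SMul ℤ (M ⟶ N) := ⟨fun n f => mkHom (n • linMap f)
  fun γ _ h => (N.deg γ).zsmul_mem (linMap_mem f h) n⟩

instance : AddCommGroup (M ⟶ N) :=
  Function.Injective.addCommGroup (fun f : M ⟶ N => linMap f) (fun _ _ h => hom_ext' h)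
    rfl (fun _ _ => rfl) (fun _ => rfl) (fun _ _ => rfl) (fun _ _ => rfl) (fun _ _ => rfl)

@[simp] theorem linMap_zero : linMap (0 : M ⟶ N) = 0 := rfl
@[simp] theorem linMap_add (f g : M ⟶ N) : linMap (f + g) = linMap f + linMap g := rfl

instance : Preadditive (GrMod.{v} 𝓡) where
  add_comp _ _ _ f g h := hom_ext' (by simp [LinearMap.comp_add])
  comp_add _ _ _ f g h := hom_ext' (by simp [LinearMap.add_comp])

theorem proj_linMap (f : M ⟶ N) (γ : G) (m : M.carrier) :
    gradedProj N.deg N.isInternal γ (linMap f m) =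
      linMap f (gradedProj M.deg M.isInternal γ m) := by
  induction m using graded_induction M.deg M.isInternal with
  | h0 => simp
  | hadd x y hx hy => simp [hx, hy]
  | hdeg δ m hm =>
    by_cases h : γ = δ
    · subst h
      rw [gradedProj_same _ _ _ _ hm, gradedProj_same _ _ _ _ (linMap_mem f hm)]
    · rw [gradedProj_ne _ _ _ hm h, gradedProj_ne _ _ _ (linMap_mem f hm) h, map_zero]

/-- The kernel of a morphism. -/
def ker (f : M ⟶ N) : GrMod.{v} 𝓡 where
  carrier := LinearMap.ker (linMap f)
  deg γ := (M.deg γ).comap (LinearMap.ker (linMap f)).subtype.toAddMonoidHom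
  isInternal := by
    refine isInternal_of_proj _ (fun γ =>
      { toFun := fun m => ⟨gradedProj M.deg M.isInternal γ m.1, by
          rw [LinearMap.mem_ker, ← proj_linMap, m.2, map_zero]⟩
        map_zero' := by simp
        map_add' := by intro x y; ext; simp }) ?_ ?_ ?_
    · intro m
      obtain ⟨s, hs⟩ := graded_sum_proj M.deg M.isInternal m.1
      have : m = ∑ γ ∈ s, (⟨gradedProj M.deg M.isInternal γ m.1, by
          rw [LinearMap.mem_ker, ← proj_linMap, m.2, map_zero]⟩ :
          LinearMap.ker (linMap f)) := by
        ext; simpa using hs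
      rw [this]
      refine AddSubgroup.sum_mem _ fun γ _ => ?_
      exact AddSubgroup.mem_iSup_of_mem γ (gradedProj_mem M.deg M.isInternal γ m.1)
    · intro γ m hm
      exact Subtype.ext (gradedProj_same M.deg M.isInternal γ m.1 hm)
    · intro γ δ h m hm
      exact Subtype.ext (gradedProj_ne M.deg M.isInternal m.1 hm h)
  smul_mem γ δ r m hr hm := M.smul_mem γ δ r m.1 hr hm

/-- The inclusion of the kernel. -/
def kerι (f : M ⟶ N) : ker f ⟶ M :=
  mkHom (LinearMap.ker (linMap f)).subtype fun _ _ h => h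

theorem kerι_comp (f : M ⟶ N) : kerι f ≫ f = 0 :=
  hom_ext' (LinearMap.ext fun m => m.2)

/-- The cokernel of a morphism. -/
def coker (f : M ⟶ N) : GrMod.{v} 𝓡 where
  carrier := N.carrier ⧸ LinearMap.range (linMap f)
  deg γ := (N.deg γ).map (LinearMap.range (linMap f)).mkQ.toAddMonoidHom
  isInternal := by
    have hp : ∀ γ, (LinearMap.range (linMap f)).toAddSubgroup ≤
        (LinearMap.range (linMap f)).toAddSubgroup.comap
          (gradedProj N.deg N.isInternal γ) := by
      rintro γ _ ⟨m, rfl⟩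
      exact ⟨_, (proj_linMap f γ m).symm⟩
    refine isInternal_of_proj _ (fun γ => QuotientAddGroup.map _ _ _ (hp γ)) ?_ ?_ ?_
    · intro m
      obtain ⟨n, rfl⟩ := (LinearMap.range (linMap f)).mkQ_surjective m
      induction n using graded_induction N.deg N.isInternal with
      | h0 => rw [map_zero]; exact AddSubgroup.zero_mem _
      | hadd x y hx hy => rw [map_add]; exact AddSubgroup.add_mem _ hx hy
      | hdeg γ n hn => exact AddSubgroup.mem_iSup_of_mem γ ⟨n, hn, rfl⟩
    · rintro γ _ ⟨n, hn, rfl⟩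
      exact congrArg (LinearMap.range (linMap f)).mkQ (gradedProj_same N.deg N.isInternal γ n hn)
    · rintro γ δ h _ ⟨n, hn, rfl⟩
      exact congrArg (LinearMap.range (linMap f)).mkQ (gradedProj_ne N.deg N.isInternal n hn h)
  smul_mem := by
    rintro γ δ r _ hr ⟨n, hn, rfl⟩
    exact ⟨r • n, N.smul_mem γ δ r n hr hn, rfl⟩

/-- The projection onto the cokernel. -/
def cokerπ (f : M ⟶ N) : N ⟶ coker f :=
  mkHom (N := coker f) (LinearMap.range (linMap f)).mkQ fun _ n h => ⟨n, h, rfl⟩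

theorem comp_cokerπ (f : M ⟶ N) : f ≫ cokerπ f = 0 :=
  hom_ext' (LinearMap.range_mkQ_comp (linMap f))

theorem comp_linMap_eq_zero {f : M ⟶ N} {g : N ⟶ P} (h : f ≫ g = 0) (m : M.carrier) :
    linMap g (linMap f m) = 0 := by
  have := congrArg (fun k => linMap k m) h
  simpa using this

instance : HasKernels (GrMod.{v} 𝓡) where
  has_limit f := ⟨⟨{
    cone := KernelFork.ofι (kerι f) (kerι_comp f)
    isLimit := KernelFork.IsLimit.ofι _ _
      (fun g hg => mkHom (N := ker f)
        ((linMap g).codRestrict _ fun m => comp_linMap_eq_zero hg m)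
        fun _ _ h => linMap_mem g h)
      (fun _ _ => rfl)
      (fun g hg k hk => hom_ext' (LinearMap.ext fun m => Subtype.ext (by
        have := congrArg (fun t => linMap t m) hk
        exact this))) }⟩⟩

instance : HasCokernels (GrMod.{v} 𝓡) where
  has_colimit f := ⟨⟨{
    cocone := CokernelCofork.ofπ (cokerπ f) (comp_cokerπ f)
    isColimit := CokernelCofork.IsColimit.ofπ _ _
      (fun g hg => mkHom (M := coker f)
        ((LinearMap.range (linMap f)).liftQ (linMap g) (by
          rintro _ ⟨m, rfl⟩; exact comp_linMap_eq_zero hg m))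
        (by rintro γ _ ⟨n, hn, rfl⟩; exact linMap_mem g hn))
      (fun _ _ => rfl)
      (fun g hg k hk => hom_ext' (LinearMap.ext fun q => by
        obtain ⟨n, rfl⟩ := (LinearMap.range (linMap f)).mkQ_surjective q
        exact congrArg (fun t => linMap t n) hk)) }⟩⟩

/-- The zero module. -/
def zeroObj : GrMod.{v} 𝓡 where
  carrier := PUnit
  deg _ := ⊤
  isInternal := isInternal_of_proj _ (fun _ => 0)
    (fun m => by rw [Subsingleton.elim m 0]; exact AddSubgroup.zero_mem _)
    (fun _ _ _ => rfl) (fun _ _ _ _ _ => rfl)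
  smul_mem _ _ _ _ _ _ := trivial

instance : HasTerminal (GrMod.{v} 𝓡) :=
  (IsTerminal.ofUniqueHom (Y := (zeroObj : GrMod.{v} 𝓡)) (fun _ => 0)
    (fun _ _ => hom_ext' (LinearMap.ext fun _ => rfl))).hasTerminal

/-- The product of two graded modules. -/
def prod (M N : GrMod.{v} 𝓡) : GrMod.{v} 𝓡 where
  carrier := M.carrier × N.carrier
  deg γ := (M.deg γ).prod (N.deg γ)
  isInternal := by
    refine isInternal_of_proj _ (fun γ => (gradedProj M.deg M.isInternal γ).prodMap
      (gradedProj N.deg N.isInternal γ)) ?_ ?_ ?_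
    · rintro ⟨m, n⟩
      have h1 : (m, (0 : N.carrier)) ∈ ⨆ γ, (M.deg γ).prod (N.deg γ) := by
        induction m using graded_induction M.deg M.isInternal with
        | h0 => exact AddSubgroup.zero_mem _
        | hadd x y hx hy => simpa using AddSubgroup.add_mem _ hx hy
        | hdeg γ m hm => exact AddSubgroup.mem_iSup_of_mem γ ⟨hm, AddSubgroup.zero_mem _⟩
      have h2 : ((0 : M.carrier), n) ∈ ⨆ γ, (M.deg γ).prod (N.deg γ) := by
        induction n using graded_induction N.deg N.isInternal with
        | h0 => exact AddSubgroup.zero_mem _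
        | hadd x y hx hy => simpa using AddSubgroup.add_mem _ hx hy
        | hdeg γ n hn => exact AddSubgroup.mem_iSup_of_mem γ ⟨AddSubgroup.zero_mem _, hn⟩
      simpa using AddSubgroup.add_mem _ h1 h2
    · rintro γ ⟨m, n⟩ ⟨hm, hn⟩
      exact Prod.ext (gradedProj_same _ _ _ _ hm) (gradedProj_same _ _ _ _ hn)
    · rintro γ δ h ⟨m, n⟩ ⟨hm, hn⟩
      exact Prod.ext (gradedProj_ne _ _ _ hm h) (gradedProj_ne _ _ _ hn h)
  smul_mem γ δ r m hr hm := ⟨M.smul_mem γ δ r m.1 hr hm.1, N.smul_mem γ δ r m.2 hr hm.2⟩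

instance : HasLimit (pair M N) where
  exists_limit := ⟨{
    cone := BinaryFan.mk (P := prod M N)
      (mkHom (M := prod M N) (LinearMap.fst R M.carrier N.carrier) fun _ _ h => h.1)
      (mkHom (M := prod M N) (LinearMap.snd R M.carrier N.carrier) fun _ _ h => h.2)
    isLimit := BinaryFan.IsLimit.mk _
      (fun f g => mkHom (N := prod M N) ((linMap f).prod (linMap g))
        fun _ _ h => AddSubgroup.mem_prod.2 ⟨linMap_mem f h, linMap_mem g h⟩)
      (fun _ _ => rfl) (fun _ _ => rfl)
      (fun _ _ _ hf hg => hom_ext' (LinearMap.ext fun m => Prod.ext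
        (congrArg (fun t => linMap t m) hf) (congrArg (fun t => linMap t m) hg))) }⟩

instance : HasBinaryProducts (GrMod.{v} 𝓡) := hasBinaryProducts_of_hasLimit_pair _

theorem injective_of_mono (f : M ⟶ N) [Mono f] : Function.Injective (linMap f) := by
  have h : kerι f = 0 := (cancel_mono f).1 (by rw [kerι_comp, zero_comp])
  rw [injective_iff_map_eq_zero]
  intro m hm
  exact congrArg (fun t : ker f ⟶ M => linMap t (show LinearMap.ker (linMap f) from ⟨m, hm⟩)) h

theorem surjective_of_epi (f : M ⟶ N) [Epi f] : Function.Surjective (linMap f) := by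
  have h : cokerπ f = 0 := (cancel_epi f).1 (by rw [comp_cokerπ, comp_zero])
  intro n
  have : (LinearMap.range (linMap f)).mkQ n = 0 := congrArg (fun t => linMap t n) h
  rw [Submodule.mkQ_apply, Submodule.Quotient.mk_eq_zero] at this
  exact this

theorem mem_deg_of_injective (f : M ⟶ N) (hf : Function.Injective (linMap f)) {γ : G}
    {m : M.carrier} (h : linMap f m ∈ N.deg γ) : m ∈ M.deg γ := by
  have := proj_linMap f γ m
  rw [gradedProj_same _ _ _ _ h] at this
  rw [hf this]
  exact gradedProj_mem _ _ _ _

theorem exists_deg_of_surjective (f : M ⟶ N) (hf : Function.Surjective (linMap f)) {γ : G}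
    {n : N.carrier} (h : n ∈ N.deg γ) : ∃ m ∈ M.deg γ, linMap f m = n := by
  obtain ⟨m, rfl⟩ := hf n
  refine ⟨gradedProj M.deg M.isInternal γ m, gradedProj_mem _ _ _ _, ?_⟩
  rw [← proj_linMap, gradedProj_same _ _ _ _ h]

/-- Every monomorphism is the kernel of its cokernel. -/
@[reducible]
noncomputable def normalMono (f : M ⟶ N) [Mono f] : NormalMono f where
  Z := coker f
  g := cokerπ f
  w := comp_cokerπ f
  isLimit := by
    have hmem : ∀ {P : GrMod.{v} 𝓡} (g : P ⟶ N), g ≫ cokerπ f = 0 →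
        ∀ m, linMap g m ∈ LinearMap.range (linMap f) := by
      intro P g hg m
      have := comp_linMap_eq_zero hg m
      exact (Submodule.Quotient.mk_eq_zero _).1 this
    have hinv : ∀ (x : LinearMap.range (linMap f)),
        linMap f ((LinearEquiv.ofInjective (linMap f) (injective_of_mono f)).symm x) = x := by
      intro x
      have := (LinearEquiv.ofInjective (linMap f) (injective_of_mono f)).apply_symm_apply x
      exact congrArg Subtype.val this
    exact KernelFork.IsLimit.ofι _ _
      (fun {P} g hg => mkHom
        ((LinearEquiv.ofInjective (linMap f) (injective_of_mono f)).symm.toLinearMap.comp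
          ((linMap g).codRestrict _ (hmem g hg)))
        fun γ m h => mem_deg_of_injective f (injective_of_mono f) (by
          have := hinv ((linMap g).codRestrict _ (hmem g hg) m)
          simp only [LinearMap.comp_apply, LinearEquiv.coe_coe]
          rw [this]
          exact linMap_mem g h))
      (fun g hg => hom_ext' (LinearMap.ext fun m => hinv _))
      (fun g hg k hk => (cancel_mono f).1 (hk.trans
        (hom_ext' (LinearMap.ext fun m =>
          (hinv ((linMap g).codRestrict _ (hmem g hg) m)).symm))))

/-- Every epimorphism is the cokernel of its kernel. -/
@[reducible]
noncomputable def normalEpi (f : M ⟶ N) [Epi f] : NormalEpi f where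
  W := ker f
  g := kerι f
  w := kerι_comp f
  isColimit := by
    have hle : ∀ {P : GrMod.{v} 𝓡} (g : M ⟶ P), kerι f ≫ g = 0 →
        LinearMap.ker (linMap f) ≤ LinearMap.ker (linMap g) := by
      intro P g hg m hm
      exact comp_linMap_eq_zero hg ⟨m, hm⟩
    have hinv : ∀ (m : M.carrier),
        ((linMap f).quotKerEquivOfSurjective (surjective_of_epi f)).symm (linMap f m) =
          (LinearMap.ker (linMap f)).mkQ m := by
      intro m
      rw [LinearEquiv.symm_apply_eq]
      rfl
    exact CokernelCofork.IsColimit.ofπ _ _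
      (fun {P} g hg => mkHom
        (((LinearMap.ker (linMap f)).liftQ (linMap g) (hle g hg)).comp
          ((linMap f).quotKerEquivOfSurjective (surjective_of_epi f)).symm.toLinearMap)
        (by
          intro γ n hn
          obtain ⟨m, hm, rfl⟩ := exists_deg_of_surjective f (surjective_of_epi f) hn
          simp only [LinearMap.comp_apply, LinearEquiv.coe_coe, hinv]
          exact linMap_mem g hm))
      (fun g hg => hom_ext' (LinearMap.ext fun m => by
        simp only [linMap_comp, linMap_mkHom, LinearMap.comp_apply, LinearEquiv.coe_coe, hinv]
        rfl))
      (fun g hg k hk => (cancel_epi f).1 (hk.trans (hom_ext' (LinearMap.ext fun m => by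
        simp only [linMap_comp, linMap_mkHom, LinearMap.comp_apply, LinearEquiv.coe_coe, hinv]
        rfl))))

noncomputable instance : Abelian (GrMod.{v} 𝓡) where
  normalMonoOfMono f _ := ⟨normalMono f⟩
  normalEpiOfEpi f _ := ⟨normalEpi f⟩
  has_finite_products := hasFiniteProducts_of_has_binary_and_terminal

instance : HasExt.{max (v + 1) uG uR} (GrMod.{v} 𝓡) := HasExt.standard _

/-- The shift `Σ_γ M`, with `(Σ_γ M)_δ = M_{γ + δ}`. -/
def shift (γ : G) (M : GrMod.{v} 𝓡) : GrMod.{v} 𝓡 where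
  carrier := M.carrier
  deg δ := M.deg (γ + δ)
  isInternal := by
    refine isInternal_of_proj _ (fun δ => gradedProj M.deg M.isInternal (γ + δ)) ?_ ?_ ?_
    · intro m
      induction m using graded_induction M.deg M.isInternal with
      | h0 => exact AddSubgroup.zero_mem _
      | hadd x y hx hy => exact AddSubgroup.add_mem _ hx hy
      | hdeg δ m hm => exact AddSubgroup.mem_iSup_of_mem (δ - γ) (by simpa using hm)
    · intro δ m hm
      exact gradedProj_same _ _ _ _ hm
    · intro δ ε h m hm
      exact gradedProj_ne _ _ _ hm (by simpa using h)
  smul_mem δ ε r m hr hm := by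
    have := M.smul_mem δ (γ + ε) r m hr hm
    rwa [add_left_comm] at this

/-- The graded algebra `R` as a graded left module over itself. -/
def self (𝓡 : G → Submodule K R) [GradedAlgebra 𝓡] : GrMod.{uR} 𝓡 where
  carrier := R
  deg γ := (𝓡 γ).toAddSubgroup
  isInternal := DirectSum.Decomposition.isInternal 𝓡
  smul_mem _ _ _ _ hr hm := SetLike.mul_mem_graded hr hm

/-- Right multiplication by a homogeneous element `r` of degree `δ`,
as a morphism `Σ_γ R ⟶ Σ_ε R` with `ε = δ + γ`. -/
def rmul [GradedAlgebra 𝓡] {γ δ ε : G} (h : δ + γ = ε) (r : R) (hr : r ∈ 𝓡 δ) :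
    shift γ (self 𝓡) ⟶ shift ε (self 𝓡) :=
  mkHom (M := shift γ (self 𝓡)) (N := shift ε (self 𝓡)) (LinearMap.toSpanSingleton R R r)
    (by
      intro η m hm
      have : (show R from m) * r ∈ 𝓡 ((γ + η) + δ) :=
        SetLike.mul_mem_graded (show (show R from m) ∈ 𝓡 (γ + η) from hm) hr
      have e : γ + η + δ = ε + η := by rw [← h]; abel
      rw [e] at this
      exact this)

/-- Two graded modules, possibly in different universes, are isomorphic as graded modules. -/
def GradedIso (M : GrMod.{v} 𝓡) (N : GrMod.{v'} 𝓡) : Prop :=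
  ∃ e : M.carrier ≃ₗ[R] N.carrier, ∀ (γ : G) (m : M.carrier), e m ∈ N.deg γ ↔ m ∈ M.deg γ

end GrMod

end GradedModules

/-! ### Enveloping algebras, graded bimodules and twists -/

section Enveloping

variable {K : Type uK} [Field K] {A : Type uA} [Ring A] [Algebra K A]
  {G : Type uG} [AddCommGroup G] [DecidableEq G]

/-- The grading of the enveloping algebra `Aᵉ = A ⊗ Aᵒ` induced by a grading of `A`. -/
def envGrading (𝒜 : G → Submodule K A) (γ : G) : Submodule K (A ⊗[K] Aᵐᵒᵖ) :=
  Submodule.span K {t | ∃ (i j : G) (a b : A), i + j = γ ∧ a ∈ 𝒜 i ∧ b ∈ 𝒜 j ∧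
    t = a ⊗ₜ[K] MulOpposite.op b}

variable (𝒜 : G → Submodule K A)

set_option linter.unusedSectionVars false in
theorem tmul_mem_envGrading {i j γ : G} {a b : A} (h : i + j = γ) (ha : a ∈ 𝒜 i) (hb : b ∈ 𝒜 j) :
    a ⊗ₜ[K] MulOpposite.op b ∈ envGrading 𝒜 γ :=
  Submodule.subset_span ⟨i, j, a, b, h, ha, hb, rfl⟩

instance envGrading_gradedMonoid [GradedAlgebra 𝒜] : SetLike.GradedMonoid (envGrading 𝒜) where
  one_mem := tmul_mem_envGrading 𝒜 (add_zero 0) SetLike.GradedOne.one_mem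
    SetLike.GradedOne.one_mem
  mul_mem γ δ x y hx hy := by
    induction hx, hy using Submodule.span_induction₂ with
    | mem_mem x y hx hy =>
      obtain ⟨i, j, a, b, rfl, ha, hb, rfl⟩ := hx
      obtain ⟨i', j', a', b', rfl, ha', hb', rfl⟩ := hy
      rw [Algebra.TensorProduct.tmul_mul_tmul, ← MulOpposite.op_mul]
      exact tmul_mem_envGrading 𝒜 (by abel) (SetLike.mul_mem_graded ha ha')
        (SetLike.mul_mem_graded hb' hb)
    | zero_left y _ => rw [zero_mul]; exact Submodule.zero_mem _
    | zero_right x _ => rw [mul_zero]; exact Submodule.zero_mem _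
    | add_left x y z _ _ _ h1 h2 => rw [add_mul]; exact Submodule.add_mem _ h1 h2
    | add_right x y z _ _ _ h1 h2 => rw [mul_add]; exact Submodule.add_mem _ h1 h2
    | smul_left r x y _ _ h => rw [smul_mul_assoc]; exact Submodule.smul_mem _ _ h
    | smul_right r x y _ _ h => rw [mul_smul_comm]; exact Submodule.smul_mem _ _ h

/-- The projection of `Aᵉ` onto its component of degree `γ`. -/
noncomputable def envProj [GradedAlgebra 𝒜] (γ : G) : A ⊗[K] Aᵐᵒᵖ →ₗ[K] A ⊗[K] Aᵐᵒᵖ :=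
  TensorProduct.lift ((DirectSum.toModule K G (Aᵐᵒᵖ →ₗ[K] A ⊗[K] Aᵐᵒᵖ) fun i =>
    ((TensorProduct.mk K A Aᵐᵒᵖ).compl₂
      ((MulOpposite.opLinearEquiv K).toLinearMap ∘ₗ (𝒜 (γ - i)).subtype ∘ₗ
        (DirectSum.component K G (fun j => 𝒜 j) (γ - i)) ∘ₗ
        (DirectSum.decomposeLinearEquiv 𝒜).toLinearMap ∘ₗ
        (MulOpposite.opLinearEquiv K).symm.toLinearMap)) ∘ₗ (𝒜 i).subtype) ∘ₗ
    (DirectSum.decomposeLinearEquiv 𝒜).toLinearMap)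

theorem envProj_tmul [GradedAlgebra 𝒜] (γ : G) {i j : G} {a b : A} (ha : a ∈ 𝒜 i) (hb : b ∈ 𝒜 j) :
    envProj 𝒜 γ (a ⊗ₜ[K] MulOpposite.op b) =
      if i + j = γ then a ⊗ₜ[K] MulOpposite.op b else 0 := by
  have hab : DirectSum.decompose 𝒜 a = DirectSum.of (fun i => 𝒜 i) i ⟨a, ha⟩ :=
    DirectSum.decompose_of_mem 𝒜 ha
  simp only [envProj, TensorProduct.lift.tmul, LinearMap.comp_apply, LinearEquiv.coe_coe,
    DirectSum.decomposeLinearEquiv_apply, hab]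
  rw [← DirectSum.lof_eq_of K, DirectSum.toModule_lof]
  simp only [LinearMap.comp_apply, Submodule.subtype_apply, LinearMap.compl₂_apply,
    LinearEquiv.coe_coe, TensorProduct.mk_apply, DirectSum.decomposeLinearEquiv_apply,
    MulOpposite.coe_opLinearEquiv, MulOpposite.coe_opLinearEquiv_symm, MulOpposite.unop_op]
  split_ifs with h
  · have e : γ - i = j := by rw [← h]; abel
    rw [e, ← DirectSum.apply_eq_component, DirectSum.decompose_of_mem_same 𝒜 hb]
  · have e : j ≠ γ - i := fun e => h (by rw [e]; abel)
    rw [← DirectSum.apply_eq_component, DirectSum.decompose_of_mem_ne 𝒜 hb e]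
    simp

theorem envGrading_isInternal [GradedAlgebra 𝒜] : DirectSum.IsInternal (envGrading 𝒜) := by
  have hp : ∀ γ δ, ∀ m ∈ envGrading 𝒜 γ, envProj 𝒜 δ m = if γ = δ then m else 0 := by
    intro γ δ m hm
    induction hm using Submodule.span_induction with
    | mem x hx =>
      obtain ⟨i, j, a, b, rfl, ha, hb, rfl⟩ := hx
      exact envProj_tmul 𝒜 δ ha hb
    | zero => simp
    | add x y _ _ hx hy => rw [map_add, hx, hy]; split_ifs <;> simp
    | smul r x _ hx => rw [map_smul, hx]; split_ifs <;> simp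
  refine isInternal_of_proj (fun γ => (envGrading 𝒜 γ).toAddSubgroup)
    (fun γ => (envProj 𝒜 γ).toAddMonoidHom) ?_ ?_ ?_
  · intro m
    induction m using TensorProduct.induction_on with
    | zero => exact AddSubgroup.zero_mem _
    | add x y hx hy => exact AddSubgroup.add_mem _ hx hy
    | tmul a b =>
      induction b using MulOpposite.rec' with
      | _ b =>
      induction a using DirectSum.Decomposition.inductionOn 𝒜 with
      | zero => rw [TensorProduct.zero_tmul]; exact AddSubgroup.zero_mem _
      | add x y hx hy => rw [TensorProduct.add_tmul]; exact AddSubgroup.add_mem _ hx hy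
      | @homogeneous i a =>
        induction b using DirectSum.Decomposition.inductionOn 𝒜 with
        | zero =>
          rw [MulOpposite.op_zero, TensorProduct.tmul_zero]; exact AddSubgroup.zero_mem _
        | add x y hx hy =>
          rw [MulOpposite.op_add, TensorProduct.tmul_add]; exact AddSubgroup.add_mem _ hx hy
        | @homogeneous j b =>
          exact AddSubgroup.mem_iSup_of_mem (i + j) (tmul_mem_envGrading 𝒜 rfl a.2 b.2)
  · intro γ m hm
    exact (hp γ γ m hm).trans (if_pos rfl)
  · intro γ δ h m hm
    exact (hp γ δ m hm).trans (if_neg h.symm)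

noncomputable instance envGrading_gradedAlgebra [GradedAlgebra 𝒜] :
    GradedAlgebra (envGrading 𝒜) where
  toDecomposition := (envGrading_isInternal 𝒜).chooseDecomposition

/-- The flip `a ⊗ bᵒ ↦ b ⊗ aᵒ` of the enveloping algebra (an anti-automorphism). -/
noncomputable def envFlip : A ⊗[K] Aᵐᵒᵖ →ₗ[K] A ⊗[K] Aᵐᵒᵖ :=
  (TensorProduct.map (MulOpposite.opLinearEquiv K).symm.toLinearMap
    (MulOpposite.opLinearEquiv K).toLinearMap) ∘ₗ (TensorProduct.comm K A Aᵐᵒᵖ).toLinearMap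

@[simp] theorem envFlip_tmul (a b : A) :
    envFlip (a ⊗ₜ[K] MulOpposite.op b) = b ⊗ₜ[K] MulOpposite.op a := rfl

theorem envFlip_one : envFlip (1 : A ⊗[K] Aᵐᵒᵖ) = 1 := rfl

theorem envFlip_mul (x y : A ⊗[K] Aᵐᵒᵖ) : envFlip (x * y) = envFlip y * envFlip x := by
  induction x using TensorProduct.induction_on with
  | zero => simp
  | add x x' hx hx' => rw [add_mul, map_add, hx, hx', map_add, mul_add]
  | tmul a b =>
    induction y using TensorProduct.induction_on with
    | zero => simp
    | add y y' hy hy' => rw [mul_add, map_add, hy, hy', map_add, add_mul]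
    | tmul a' b' =>
      induction b using MulOpposite.rec' with
      | _ b =>
      induction b' using MulOpposite.rec' with
      | _ b' =>
      simp only [Algebra.TensorProduct.tmul_mul_tmul, ← MulOpposite.op_mul, envFlip_tmul]

theorem envFlip_mem {γ : G} {x : A ⊗[K] Aᵐᵒᵖ} (hx : x ∈ envGrading 𝒜 γ) :
    envFlip x ∈ envGrading 𝒜 γ := by
  induction hx using Submodule.span_induction with
  | mem x hx =>
    obtain ⟨i, j, a, b, rfl, ha, hb, rfl⟩ := hx
    exact tmul_mem_envGrading 𝒜 (add_comm j i) hb ha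
  | zero => rw [map_zero]; exact Submodule.zero_mem _
  | add x y _ _ hx hy => rw [map_add]; exact Submodule.add_mem _ hx hy
  | smul r x _ hx => rw [map_smul]; exact Submodule.smul_mem _ _ hx

/-- `Aut_G(A)`: the group of algebra automorphisms of `A` that preserve degrees. -/
def gradedAut : Subgroup (A ≃ₐ[K] A) where
  carrier := {σ | ∀ (γ : G) (a : A), σ a ∈ 𝒜 γ ↔ a ∈ 𝒜 γ}
  one_mem' _ _ := Iff.rfl
  mul_mem' {σ τ} hσ hτ γ a := (hσ γ (τ a)).trans (hτ γ a)
  inv_mem' {σ} hσ γ a := by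
    have := hσ γ (σ⁻¹ a)
    rw [← AlgEquiv.mul_apply, mul_inv_cancel] at this
    exact this.symm

/-- The endomorphism `μ ⊗ νᵒ` of `Aᵉ`. -/
noncomputable def envMap (μ ν : A ≃ₐ[K] A) : A ⊗[K] Aᵐᵒᵖ →ₐ[K] A ⊗[K] Aᵐᵒᵖ :=
  Algebra.TensorProduct.map μ.toAlgHom (AlgHom.op ν.toAlgHom)

@[simp] theorem envMap_tmul (μ ν : A ≃ₐ[K] A) (a b : A) :
    envMap μ ν (a ⊗ₜ[K] MulOpposite.op b) = μ a ⊗ₜ[K] MulOpposite.op (ν b) := rfl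

theorem envMap_mem (μ ν : gradedAut 𝒜) {γ : G} {x : A ⊗[K] Aᵐᵒᵖ} (hx : x ∈ envGrading 𝒜 γ) :
    envMap μ.1 ν.1 x ∈ envGrading 𝒜 γ := by
  induction hx using Submodule.span_induction with
  | mem x hx =>
    obtain ⟨i, j, a, b, rfl, ha, hb, rfl⟩ := hx
    exact tmul_mem_envGrading 𝒜 rfl ((μ.2 i a).2 ha) ((ν.2 j b).2 hb)
  | zero => rw [map_zero]; exact Submodule.zero_mem _
  | add x y _ _ hx hy => rw [map_add]; exact Submodule.add_mem _ hx hy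
  | smul r x _ hx => rw [map_smul]; exact Submodule.smul_mem _ _ hx

/-- The graded bimodule `^μ M ^ν`: the actions are `a * m = μ(a) m` and `m * a = m ν(a)`. -/
noncomputable def twist {𝒜 : G → Submodule K A} (μ ν : gradedAut 𝒜)
    (M : GrMod.{v} (envGrading 𝒜)) : GrMod.{v} (envGrading 𝒜) where
  carrier := M.carrier
  addCommGroup := M.addCommGroup
  module := Module.compHom M.carrier (envMap μ.1 ν.1).toRingHom
  deg := M.deg
  isInternal := M.isInternal
  smul_mem γ δ r m hr hm := M.smul_mem γ δ (envMap μ.1 ν.1 r) m (envMap_mem 𝒜 μ ν hr) hm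

/-- `A` as a graded bimodule over itself: `(a ⊗ bᵒ) • m = a m b`. -/
noncomputable def regularBimodule [GradedAlgebra 𝒜] : GrMod.{uA} (envGrading 𝒜) where
  carrier := A
  module := TensorProduct.Algebra.module
  deg γ := (𝒜 γ).toAddSubgroup
  isInternal := DirectSum.Decomposition.isInternal 𝒜
  smul_mem γ δ r m hr hm := by
    change TensorProduct.Algebra.moduleAux r m ∈ 𝒜 (γ + δ)
    induction hr using Submodule.span_induction with
    | mem x hx =>
      obtain ⟨i, j, a, b, rfl, ha, hb, rfl⟩ := hx
      rw [TensorProduct.Algebra.moduleAux_apply]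
      have h := SetLike.mul_mem_graded ha (SetLike.mul_mem_graded hm hb)
      have e : i + (δ + j) = i + j + δ := by abel
      rw [e] at h
      exact h
    | zero => rw [map_zero]; exact Submodule.zero_mem _
    | add x y _ _ hx hy => rw [map_add]; exact Submodule.add_mem _ hx hy
    | smul c x _ hx => rw [map_smul]; exact Submodule.smul_mem _ _ hx

/-- The degree `γ` component `Ext^d(X, Σ_γ Aᵉ)` of `uExt^d(X, Aᵉ)`, where `Ext` is taken in the
abelian category of graded bimodules. -/
def extComponent [GradedAlgebra 𝒜] (X : GrMod.{uA} (envGrading 𝒜)) (d : ℕ) (γ : G) :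
    Type (max (uA + 1) uG) :=
  Ext.{max (uA + 1) uG} X (GrMod.shift γ (GrMod.self (envGrading 𝒜))) d

noncomputable instance [GradedAlgebra 𝒜] (X : GrMod.{uA} (envGrading 𝒜)) (d : ℕ) (γ : G) :
    AddCommGroup (extComponent 𝒜 X d γ) :=
  inferInstanceAs (AddCommGroup (Ext.{max (uA + 1) uG} X
    (GrMod.shift γ (GrMod.self (envGrading 𝒜))) d))

/-- The action of a homogeneous element `r ∈ Aᵉ` on `uExt^d(X, Aᵉ)`. The right multiplications of
`Aᵉ` make `uExt^d(X, Aᵉ)` a right `Aᵉ`-module; a right `Aᵉ`-module is a bimodule via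
`a x b = x · (b ⊗ aᵒ)`, so `a ⊗ bᵒ` acts through right multiplication by its flip `b ⊗ aᵒ`. -/
noncomputable def extSMul [GradedAlgebra 𝒜] (X : GrMod.{uA} (envGrading 𝒜)) (d : ℕ) {γ δ ε : G}
    (h : γ + δ = ε) (r : envGrading 𝒜 γ)
    (x : Ext.{max (uA + 1) uG} X (GrMod.shift δ (GrMod.self (envGrading 𝒜))) d) :
    Ext.{max (uA + 1) uG} X (GrMod.shift ε (GrMod.self (envGrading 𝒜))) d :=
  x.comp (Ext.mk₀ (GrMod.rmul h (envFlip (r : A ⊗[K] Aᵐᵒᵖ)) (envFlip_mem 𝒜 r.2))) (add_zero d)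

theorem extSMul_one [GradedAlgebra 𝒜] (X : GrMod.{uA} (envGrading 𝒜)) (d : ℕ) {δ : G}
    (x : Ext.{max (uA + 1) uG} X (GrMod.shift δ (GrMod.self (envGrading 𝒜))) d) :
    extSMul 𝒜 X d (zero_add δ) (⟨1, SetLike.GradedOne.one_mem⟩ : envGrading 𝒜 0) x = x := by
  have : GrMod.rmul (zero_add δ) (envFlip (1 : A ⊗[K] Aᵐᵒᵖ))
      (envFlip_mem 𝒜 SetLike.GradedOne.one_mem) =
      𝟙 (GrMod.shift δ (GrMod.self (envGrading 𝒜))) := by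
    refine GrMod.hom_ext' (LinearMap.ext fun m => ?_)
    exact mul_one (show A ⊗[K] Aᵐᵒᵖ from m)
  simp only [extSMul, this, Ext.comp_mk₀_id]

theorem extSMul_mul [GradedAlgebra 𝒜] (X : GrMod.{uA} (envGrading 𝒜)) (d : ℕ) {γ γ' δ ε η : G}
    (h : γ' + δ = ε) (h' : γ + ε = η) (r : envGrading 𝒜 γ) (s : envGrading 𝒜 γ')
    (x : Ext.{max (uA + 1) uG} X (GrMod.shift δ (GrMod.self (envGrading 𝒜))) d) :
    extSMul 𝒜 X d h' r (extSMul 𝒜 X d h s x) =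
      extSMul 𝒜 X d (by rw [← h', ← h, add_assoc] : (γ + γ') + δ = η)
        (⟨r.1 * s.1, SetLike.mul_mem_graded r.2 s.2⟩ : envGrading 𝒜 (γ + γ')) x := by
  simp only [extSMul]
  rw [Ext.comp_assoc_of_third_deg_zero, Ext.mk₀_comp_mk₀]
  congr 2
  refine GrMod.hom_ext' (LinearMap.ext fun m => ?_)
  change ((show A ⊗[K] Aᵐᵒᵖ from m) * envFlip s.1) * envFlip r.1 =
    (show A ⊗[K] Aᵐᵒᵖ from m) * envFlip (r.1 * s.1)
  rw [envFlip_mul, mul_assoc]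

theorem extSMul_add [GradedAlgebra 𝒜] (X : GrMod.{uA} (envGrading 𝒜)) (d : ℕ) {γ δ ε : G}
    (h : γ + δ = ε) (r : envGrading 𝒜 γ)
    (x y : Ext.{max (uA + 1) uG} X (GrMod.shift δ (GrMod.self (envGrading 𝒜))) d) :
    extSMul 𝒜 X d h r (x + y) = extSMul 𝒜 X d h r x + extSMul 𝒜 X d h r y :=
  Ext.add_comp _ _ _ _

theorem add_extSMul [GradedAlgebra 𝒜] (X : GrMod.{uA} (envGrading 𝒜)) (d : ℕ) {γ δ ε : G}
    (h : γ + δ = ε) (r s : envGrading 𝒜 γ)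
    (x : Ext.{max (uA + 1) uG} X (GrMod.shift δ (GrMod.self (envGrading 𝒜))) d) :
    extSMul 𝒜 X d h (r + s) x = extSMul 𝒜 X d h r x + extSMul 𝒜 X d h s x := by
  simp only [extSMul]
  rw [← Ext.comp_add, ← Ext.mk₀_add]
  congr 2
  refine GrMod.hom_ext' (LinearMap.ext fun m => ?_)
  change (show A ⊗[K] Aᵐᵒᵖ from m) * envFlip (r.1 + s.1) =
    (show A ⊗[K] Aᵐᵒᵖ from m) * envFlip r.1 + (show A ⊗[K] Aᵐᵒᵖ from m) * envFlip s.1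
  rw [map_add, mul_add]

theorem extSMul_zero [GradedAlgebra 𝒜] (X : GrMod.{uA} (envGrading 𝒜)) (d : ℕ) {γ δ ε : G}
    (h : γ + δ = ε) (r : envGrading 𝒜 γ) :
    extSMul 𝒜 X d h r (0 : Ext.{max (uA + 1) uG} X (GrMod.shift δ (GrMod.self (envGrading 𝒜))) d) = 0 := by
  have := extSMul_add 𝒜 X d h r 0 0
  rw [add_zero] at this
  exact left_eq_add.1 this

theorem zero_extSMul [GradedAlgebra 𝒜] (X : GrMod.{uA} (envGrading 𝒜)) (d : ℕ) {γ δ ε : G}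
    (h : γ + δ = ε) (x : Ext.{max (uA + 1) uG} X (GrMod.shift δ (GrMod.self (envGrading 𝒜))) d) :
    extSMul 𝒜 X d h 0 x = 0 := by
  have := add_extSMul 𝒜 X d h 0 0 x
  rw [add_zero] at this
  exact left_eq_add.1 this

theorem extSMul_mk_eq [GradedAlgebra 𝒜] (X : GrMod.{uA} (envGrading 𝒜)) (d : ℕ) {γ δ ε ε' : G}
    (h : γ + δ = ε) (h' : γ + δ = ε') (r : envGrading 𝒜 γ) (x : extComponent 𝒜 X d δ) :
    (GradedMonoid.mk ε (extSMul 𝒜 X d h r x) : GradedMonoid (extComponent 𝒜 X d)) =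
      GradedMonoid.mk ε' (extSMul 𝒜 X d h' r x) := by
  subst h; subst h'; rfl

noncomputable instance extGmodule [GradedAlgebra 𝒜] (X : GrMod.{uA} (envGrading 𝒜)) (d : ℕ) :
    DirectSum.Gmodule (fun γ => envGrading 𝒜 γ) (extComponent 𝒜 X d) where
  smul r x := extSMul 𝒜 X d rfl r x
  one_smul := by
    rintro ⟨δ, x⟩
    refine (extSMul_mk_eq 𝒜 X d rfl (zero_add δ) _ x).trans ?_
    exact congrArg (GradedMonoid.mk δ) (extSMul_one 𝒜 X d x)
  mul_smul := by
    rintro ⟨γ, r⟩ ⟨γ', s⟩ ⟨δ, x⟩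
    refine (extSMul_mk_eq 𝒜 X d rfl (add_assoc γ γ' δ) _ x).trans ?_
    exact congrArg (GradedMonoid.mk _) (extSMul_mul 𝒜 X d rfl rfl r s x).symm
  smul_add r x y := extSMul_add 𝒜 X d rfl r x y
  smul_zero r := extSMul_zero 𝒜 X d rfl r
  add_smul r s x := add_extSMul 𝒜 X d rfl r s x
  zero_smul x := zero_extSMul 𝒜 X d rfl x

/-- `uExt^d(X, Aᵉ) = ⨁_γ Ext^d(X, Σ_γ Aᵉ)` as a graded bimodule. -/
noncomputable def uExt [GradedAlgebra 𝒜] (X : GrMod.{uA} (envGrading 𝒜)) (d : ℕ) :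
    GrMod.{max (uA + 1) uG} (envGrading 𝒜) where
  carrier := ⨁ γ, extComponent 𝒜 X d γ
  module := Module.compHom (⨁ γ, extComponent 𝒜 X d γ)
    (DirectSum.decomposeRingEquiv (envGrading 𝒜)).toRingHom
  deg γ := (DirectSum.of (extComponent 𝒜 X d) γ).range
  isInternal := by
    refine isInternal_of_proj _ (fun γ => (DirectSum.of (extComponent 𝒜 X d) γ).comp
      (DFinsupp.evalAddMonoidHom γ)) ?_ ?_ ?_
    · intro m
      induction m using DirectSum.induction_on with
      | zero => exact AddSubgroup.zero_mem _
      | of i x => exact AddSubgroup.mem_iSup_of_mem i ⟨x, rfl⟩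
      | add x y hx hy => exact AddSubgroup.add_mem _ hx hy
    · rintro γ _ ⟨x, rfl⟩
      exact congrArg (DirectSum.of (extComponent 𝒜 X d) γ) (DirectSum.of_eq_same γ x)
    · rintro γ δ h _ ⟨x, rfl⟩
      exact (congrArg (DirectSum.of (extComponent 𝒜 X d) δ)
        (DirectSum.of_eq_of_ne γ δ x h)).trans (map_zero _)
  smul_mem := by
    rintro γ δ r _ hr ⟨x, rfl⟩
    change DirectSum.decompose (envGrading 𝒜) r • DirectSum.of (extComponent 𝒜 X d) δ x ∈ _
    rw [DirectSum.decompose_of_mem _ hr, DirectSum.Gmodule.of_smul_of]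
    exact ⟨_, rfl⟩

end Enveloping

/-! ### Units, inner automorphisms, skew elements -/

section Skew

variable {K : Type uK} [Field K] {A : Type uA} [Ring A] [Algebra K A]
  {G : Type uG} [AddCommGroup G] [DecidableEq G] (𝒜 : G → Submodule K A) [GradedAlgebra 𝒜]

theorem unit_mul_inv (ξ : (𝒜 0)ˣ) : ((ξ : 𝒜 0) : A) * ((ξ⁻¹ : (𝒜 0)ˣ) : 𝒜 0) = 1 :=
  congrArg (fun x : 𝒜 0 => (x : A)) ξ.mul_inv

theorem unit_inv_mul (ξ : (𝒜 0)ˣ) : (((ξ⁻¹ : (𝒜 0)ˣ) : 𝒜 0) : A) * (ξ : 𝒜 0) = 1 :=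
  congrArg (fun x : 𝒜 0 => (x : A)) ξ.inv_mul

theorem unit_conj_mem (ξ : (𝒜 0)ˣ) {γ : G} {a : A} (ha : a ∈ 𝒜 γ) :
    ((ξ : 𝒜 0) : A) * a * ((ξ⁻¹ : (𝒜 0)ˣ) : 𝒜 0) ∈ 𝒜 γ := by
  have h := SetLike.mul_mem_graded (SetLike.mul_mem_graded (ξ : 𝒜 0).2 ha)
    ((ξ⁻¹ : (𝒜 0)ˣ) : 𝒜 0).2
  rwa [zero_add, add_zero] at h

theorem unit_conj_conj (ξ : (𝒜 0)ˣ) (a : A) :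
    (((ξ⁻¹ : (𝒜 0)ˣ) : 𝒜 0) : A) * (((ξ : 𝒜 0) : A) * a * ((ξ⁻¹ : (𝒜 0)ˣ) : 𝒜 0)) *
      (ξ : 𝒜 0) = a := by
  rw [mul_assoc, mul_assoc, mul_assoc, unit_inv_mul, mul_one, ← mul_assoc, unit_inv_mul, one_mul]

/-- The inner automorphism `c_ξ : a ↦ ξ a ξ⁻¹` defined by a unit `ξ` of `A_0`. -/
def innerAut (ξ : (𝒜 0)ˣ) : gradedAut 𝒜 where
  val :=
    { toFun := fun a => ((ξ : 𝒜 0) : A) * a * ((ξ⁻¹ : (𝒜 0)ˣ) : 𝒜 0)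
      invFun := fun a => (((ξ⁻¹ : (𝒜 0)ˣ) : 𝒜 0) : A) * a * (ξ : 𝒜 0)
      left_inv := unit_conj_conj 𝒜 ξ
      right_inv := fun a => by simpa using unit_conj_conj 𝒜 ξ⁻¹ a
      map_mul' := fun a b => by
        have h := unit_inv_mul 𝒜 ξ
        calc _ = ((ξ : 𝒜 0) : A) * a * 1 * b * ((ξ⁻¹ : (𝒜 0)ˣ) : 𝒜 0) := by
              simp only [mul_one, mul_assoc]
          _ = _ := by rw [← h]; simp only [mul_assoc]
      map_add' := fun a b => by rw [mul_add, add_mul]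
      commutes' := fun c => by
        rw [← Algebra.commutes, mul_assoc, unit_mul_inv, mul_one] }
  property γ a := by
    refine ⟨fun h => ?_, fun h => unit_conj_mem 𝒜 ξ h⟩
    have := unit_conj_mem 𝒜 ξ⁻¹ h
    simp only [inv_inv] at this
    exact (unit_conj_conj 𝒜 ξ a) ▸ this

/-- `z` is `σ`-skew: `z a = σ(a) z` for all `a`, and `σ(z) = z`. -/
def IsSkew (σ : A ≃ₐ[K] A) (z : A) : Prop :=
  (∀ a : A, z * a = σ a * z) ∧ σ z = z

/-- `z` is normal: `z A = A z`. -/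
def IsNormalElement (z : A) : Prop :=
  Set.range (fun a : A => z * a) = Set.range (fun a : A => a * z)

end Skew

/-! A graded automorphism `σ` twists bimodules: `M ↦ ^σ M ^σ` is an exact autoequivalence, `σ`
identifies `A` with its twist, and `σ ⊗ σᵒ` does the same for `Aᵉ`. So `σ⁻¹` acts on `H = uExt^d(A,
Aᵉ)` by an additive map `Φ_σ` (`uExtTwist`) with `Φ_σ(a x b) = σ⁻¹(a) Φ_σ(x) σ⁻¹(b)` and `Φ_τ Φ_σ =
Φ_{στ}`.

A `σ`-skew element `z` of degree `γ` ties this action to the bimodule structure. Left multiplication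
by `z` is a natural transformation `M ⟶ Σ_γ ^σ M`, right multiplication by `z` is one `^σ M ^σ ⟶ Σ_γ
^σ M`, and on `A` the identity `z a = σ(a) z` says that the first is `σ` followed by the second.
Since the maps on `Ext` induced by exact functors are natural (`mapExactFunctor_naturality`),
comparing the two gives `x z = z Φ_σ(x)` in `H` (`smul_eq_smul_uExtTwist`).

The hypothesis turns `H` into `A` with action `a m μ(b)`, so `Φ_σ` is determined by `Φ_σ(1)`; put
`Ξ(σ) = σ(Φ_σ(1))`. The composition law of the `Φ_σ` is the cocycle identity, which also makes
`Ξ(σ)` a unit. Computing `Φ_σ(μ(b))` through the left and through the right action gives the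
commutator formula, and `x z = z Φ_σ(x)` at `x = 1` gives `μ(z) = Ξ(σ) z` (`exists_cocycle`). A
homogeneous regular normal element is skew for the automorphism that it defines (`exists_isSkew`),
and a central element is skew for the identity. -/

/-! ### Naturality of the maps induced on `Ext` by exact functors -/

section ExtFunctoriality

universe w₁ w₂ w₃ v₁ v₂ v₃ u₁ u₂ u₃

variable {C : Type u₁} [Category.{v₁} C] [Abelian C] [HasExt.{w₁} C]
  {D : Type u₂} [Category.{v₂} D] [Abelian D] [HasExt.{w₂} D]
  {E : Type u₃} [Category.{v₃} E] [Abelian E] [HasExt.{w₃} E]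

/-- In a category with enough projectives, every `Ext` class is obtained from morphisms by
composition with classes of short exact sequences. -/
theorem ext_induction_of_enoughProjectives [EnoughProjectives C] {Y : C}
    {p : ∀ (X : C) (n : ℕ), Ext.{w₁} X Y n → Prop}
    (hmk : ∀ (X : C) (f : X ⟶ Y), p X 0 (Ext.mk₀ f))
    (hext : ∀ (S : ShortComplex C) (hS : S.ShortExact) (n : ℕ) (y : Ext.{w₁} S.X₁ Y n),
      p S.X₁ n y → p S.X₃ (n + 1) (hS.extClass.comp y (add_comm 1 n)))
    {X : C} {n : ℕ} (x : Ext.{w₁} X Y n) : p X n x := by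
  induction n generalizing X with
  | zero =>
    obtain ⟨f, rfl⟩ := (Ext.mk₀_bijective X Y).2 x
    exact hmk X f
  | succ n hn =>
    let P : ProjectivePresentation X := Classical.arbitrary _
    let S := ShortComplex.mk _ _ (kernel.condition P.f)
    have hP : Projective S.X₂ := P.projective
    have hS : S.ShortExact := { exact := ShortComplex.exact_kernel P.f }
    -- Positive-degree `Ext` out of a projective vanishes, so `x` comes from degree `n` through the
    -- connecting map.
    have hsub : Subsingleton (Ext.{w₁} S.X₂ Y (n + 1)) := Ext.subsingleton_of_projective _ _ _
    obtain ⟨y, rfl⟩ := Ext.contravariant_sequence_exact₃ hS Y x (Subsingleton.elim _ _)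
      (add_comm 1 n)
    exact hext S hS n y (hn y)

/-- Both sides are compatible with Yoneda composition, so it is enough to treat morphisms, where
this is naturality of `α`, and classes of short exact sequences, where `α` is a morphism from the
image of the sequence under `F` to its image under `G`. -/
theorem mapExactFunctor_naturality [EnoughProjectives C] {F G : C ⥤ D} [F.Additive]
    [PreservesFiniteLimits F] [PreservesFiniteColimits F] [G.Additive] [PreservesFiniteLimits G]
    [PreservesFiniteColimits G] (α : F ⟶ G) {X Y : C} {n : ℕ} (x : Ext.{w₁} X Y n) :
    (x.mapExactFunctor F : Ext.{w₂} _ _ n).comp (Ext.mk₀ (α.app Y)) (add_zero n) =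
      (Ext.mk₀ (α.app X)).comp (x.mapExactFunctor G : Ext.{w₂} _ _ n) (zero_add n) := by
  induction x using ext_induction_of_enoughProjectives with
  | hmk X f => simp [Ext.mapExactFunctor_mk₀]
  | hext S hS n y hy =>
    have h : (hS.extClass.mapExactFunctor F : Ext.{w₂} _ _ 1).comp (Ext.mk₀ (α.app S.X₁))
        (add_zero 1) = (Ext.mk₀ (α.app S.X₃)).comp
          (hS.extClass.mapExactFunctor G : Ext.{w₂} _ _ 1) (zero_add 1) := by
      rw [Ext.mapExactFunctor_extClass, Ext.mapExactFunctor_extClass]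
      exact ShortComplex.ShortExact.extClass_naturality (hS.map_of_exact F) (hS.map_of_exact G)
        (S.mapNatTrans α)
    rw [Ext.mapExactFunctor_comp, Ext.mapExactFunctor_comp, Ext.comp_assoc_of_third_deg_zero, hy,
      ← Ext.comp_assoc_of_second_deg_zero, h]
    exact Ext.comp_assoc _ _ _ _ _ (by omega)

/-- Needed because left multiplication by a skew element is a transformation out of the identity
functor. -/
theorem mapExactFunctor_id [EnoughProjectives C] {X Y : C} {n : ℕ} (x : Ext.{w₁} X Y n) :
    (x.mapExactFunctor (𝟭 C) : Ext.{w₁} X Y n) = x := by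
  induction x using ext_induction_of_enoughProjectives with
  | hmk X f => exact Ext.mapExactFunctor_mk₀ _ f
  | hext S hS n y hy =>
    refine (Ext.mapExactFunctor_comp (𝟭 C) hS.extClass y (add_comm 1 n)).trans ?_
    rw [Ext.mapExactFunctor_extClass]
    exact congrArg (fun t => hS.extClass.comp t (add_comm 1 n)) hy

theorem mapExactFunctor_mapExactFunctor [EnoughProjectives C] (F : C ⥤ D) (G : D ⥤ E)
    [F.Additive] [PreservesFiniteLimits F] [PreservesFiniteColimits F]
    [G.Additive] [PreservesFiniteLimits G] [PreservesFiniteColimits G]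
    {X Y : C} {n : ℕ} (x : Ext.{w₁} X Y n) :
    ((x.mapExactFunctor F : Ext.{w₂} _ _ n).mapExactFunctor G : Ext.{w₃} _ _ n) =
      x.mapExactFunctor (F ⋙ G) := by
  induction x using ext_induction_of_enoughProjectives with
  | hmk X f => simp [Ext.mapExactFunctor_mk₀]
  | hext S hS n y hy =>
    have h : ((hS.extClass.mapExactFunctor F : Ext.{w₂} _ _ 1).mapExactFunctor G :
        Ext.{w₃} _ _ 1) = hS.extClass.mapExactFunctor (F ⋙ G) := by
      rw [Ext.mapExactFunctor_extClass, Ext.mapExactFunctor_extClass]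
      exact Ext.mapExactFunctor_extClass G (hS.map_of_exact F)
    rw [Ext.mapExactFunctor_comp, Ext.mapExactFunctor_comp, Ext.mapExactFunctor_comp, hy, h]

end ExtFunctoriality

/-! ### Free graded modules and enough projectives -/

section EnoughProjectives

variable {K : Type uK} [Field K] {R : Type uR} [Ring R] [Algebra K R]
  {G : Type uG} [AddCommGroup G] [DecidableEq G]

namespace GrMod

theorem epi_of_surjective {𝓡 : G → Submodule K R} {M N : GrMod.{v} 𝓡} (f : M ⟶ N)
    (hf : Function.Surjective (linMap f)) : Epi f where
  left_cancellation g h e := hom_ext' (LinearMap.ext fun n => by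
    obtain ⟨m, rfl⟩ := hf n
    exact congrArg (fun t => linMap t m) e)

/-- The free graded module on generators `s : S` of degrees `c s`. -/
noncomputable def free (𝓡 : G → Submodule K R) [GradedAlgebra 𝓡] {S : Type uR} (c : S → G) :
    GrMod.{uR} 𝓡 where
  carrier := S →₀ R
  deg γ :=
    { carrier := {f | ∀ s, f s ∈ 𝓡 (γ - c s)}
      zero_mem' := fun s => Submodule.zero_mem _
      add_mem' := fun hf hg s => Submodule.add_mem _ (hf s) (hg s)
      neg_mem' := fun hf s => Submodule.neg_mem _ (hf s) }
  isInternal := by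
    have hR : DirectSum.IsInternal fun γ => (𝓡 γ).toAddSubgroup :=
      DirectSum.Decomposition.isInternal 𝓡
    -- The generator `s` sits in degree `c s`, so the part of degree `γ` has its coefficient at `s`
    -- in degree `γ - c s`.
    refine isInternal_of_proj _ (fun γ => Finsupp.liftAddHom fun s =>
      (Finsupp.singleAddHom s).comp (gradedProj _ hR (γ - c s))) ?_ ?_ ?_
    · intro f
      induction f using Finsupp.induction_linear with
      | zero => exact AddSubgroup.zero_mem _
      | add f g hf hg => exact AddSubgroup.add_mem _ hf hg
      | single s r =>
        induction r using graded_induction _ hR with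
        | h0 => rw [Finsupp.single_zero]; exact AddSubgroup.zero_mem _
        | hadd x y hx hy => rw [Finsupp.single_add]; exact AddSubgroup.add_mem _ hx hy
        | hdeg γ r hr =>
          refine AddSubgroup.mem_iSup_of_mem (γ + c s) fun t => ?_
          by_cases h : s = t
          · subst h; rw [Finsupp.single_eq_same, add_sub_cancel_right]; exact hr
          · rw [Finsupp.single_eq_of_ne' h]; exact Submodule.zero_mem _
    · intro γ f hf
      rw [Finsupp.liftAddHom_apply]
      conv_rhs => rw [← Finsupp.sum_single f]
      exact Finsupp.sum_congr fun s _ => congrArg (Finsupp.single s)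
        (gradedProj_same _ hR _ _ (hf s))
    · intro γ δ h f hf
      rw [Finsupp.liftAddHom_apply]
      refine Finset.sum_eq_zero fun s _ => ?_
      have : gradedProj _ hR (δ - c s) (f s) = 0 :=
        gradedProj_ne _ hR _ (hf s) fun e => h (sub_left_inj.1 e)
      simp [this]
  smul_mem γ δ r f hr hf s := by
    have := SetLike.mul_mem_graded hr (hf s)
    rwa [← add_sub_assoc] at this

variable {𝓡 : G → Submodule K R} [GradedAlgebra 𝓡] {S : Type uR} {c : S → G}

/-- The morphism from a free graded module given by the images of the generators. -/
noncomputable def freeLift {M : GrMod.{uR} 𝓡} (m : S → M.carrier) (hm : ∀ s, m s ∈ M.deg (c s)) :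
    free 𝓡 c ⟶ M :=
  mkHom (M := free 𝓡 c) (Finsupp.linearCombination R m) fun γ f hf => by
    refine AddSubgroup.sum_mem (M.deg γ) fun s _ => ?_
    have := M.smul_mem _ _ _ _ (hf s) (hm s)
    rwa [sub_add_cancel] at this

theorem freeLift_single {M : GrMod.{uR} 𝓡} (m : S → M.carrier) (hm : ∀ s, m s ∈ M.deg (c s))
    (s : S) : linMap (freeLift m hm) (Finsupp.single s (1 : R)) = m s :=
  (Finsupp.linearCombination_single R (1 : R) s).trans (one_smul _ _)

theorem single_mem_free (s : S) : Finsupp.single s (1 : R) ∈ (free 𝓡 c).deg (c s) := by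
  intro t
  by_cases h : s = t
  · subst h; rw [Finsupp.single_eq_same, sub_self]; exact SetLike.GradedOne.one_mem
  · rw [Finsupp.single_eq_of_ne' h]; exact Submodule.zero_mem _

theorem free_hom_ext {M : GrMod.{uR} 𝓡} {f g : free 𝓡 c ⟶ M}
    (h : ∀ s, linMap f (Finsupp.single s (1 : R)) = linMap g (Finsupp.single s (1 : R))) :
    f = g :=
  hom_ext' (Finsupp.lhom_ext' fun s => LinearMap.ext_ring (h s))

/-- An epimorphism is surjective in each degree, so the image of each generator lifts to an element
of the same degree. -/
instance : Projective (free 𝓡 c) where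
  factors {E X} f e he := by
    choose m hm hme using fun s => exists_deg_of_surjective e (surjective_of_epi e)
      (linMap_mem f (single_mem_free (𝓡 := 𝓡) (c := c) s))
    refine ⟨freeLift m hm, free_hom_ext fun s => ?_⟩
    exact (congrArg (linMap e) (freeLift_single m hm s)).trans (hme s)

/-- This is what makes the induction on `Ext` classes available. The cover has one generator for
each homogeneous element. -/
instance : EnoughProjectives (GrMod.{uR} 𝓡) where
  presentation M := by
    let S := {m : M.carrier // ∃ γ, m ∈ M.deg γ}
    -- The zero element lies in every degree, so a degree has to be chosen.
    let c : S → G := fun s => s.2.choose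
    refine ⟨{ p := free 𝓡 c, f := freeLift (fun s => s.1) fun s => s.2.choose_spec, epi := ?_ }⟩
    refine epi_of_surjective _ fun m => ?_
    induction m using graded_induction M.deg M.isInternal with
    | h0 => exact ⟨0, map_zero _⟩
    | hadd x y hx hy =>
      obtain ⟨a, rfl⟩ := hx
      obtain ⟨b, rfl⟩ := hy
      exact ⟨a + b, map_add _ _ _⟩
    | hdeg γ m hm => exact ⟨Finsupp.single ⟨m, γ, hm⟩ 1, freeLift_single _ _ _⟩

end GrMod

end EnoughProjectives

/-! ### Twisting and shifting as exact functors -/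

section TwistFunctor

variable {K : Type uK} [Field K] {A : Type uA} [Ring A] [Algebra K A]

theorem env_induction {p : A ⊗[K] Aᵐᵒᵖ → Prop} (h0 : p 0)
    (hadd : ∀ x y, p x → p y → p (x + y))
    (htmul : ∀ a b : A, p (a ⊗ₜ[K] MulOpposite.op b)) (r : A ⊗[K] Aᵐᵒᵖ) : p r :=
  TensorProduct.induction_on r h0 (fun a b => htmul a b.unop) hadd

theorem envMap_envMap (σ ν τ π : A ≃ₐ[K] A) (r : A ⊗[K] Aᵐᵒᵖ) :
    envMap σ ν (envMap τ π r) = envMap (σ * τ) (ν * π) r := by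
  induction r using env_induction with
  | h0 => simp
  | hadd x y hx hy => simp [hx, hy]
  | htmul a b => rfl

theorem envMap_one_one (r : A ⊗[K] Aᵐᵒᵖ) : envMap (1 : A ≃ₐ[K] A) 1 r = r := by
  induction r using env_induction with
  | h0 => simp
  | hadd x y hx hy => rw [map_add, hx, hy]
  | htmul a b => rfl

/-- The flip exchanges the tensor factors, hence the two automorphisms. For equal twists on both
sides it commutes with `envMap`, which gives the semilinearity of the action on `Ext`. -/
theorem envFlip_envMap (σ ν : A ≃ₐ[K] A) (r : A ⊗[K] Aᵐᵒᵖ) :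
    envFlip (envMap σ ν r) = envMap ν σ (envFlip r) := by
  induction r using env_induction with
  | h0 => simp
  | hadd x y hx hy => simp [hx, hy]
  | htmul a b => rfl

theorem envMap_envMap_inv {ι : Type*} {𝒜 : ι → Submodule K A} (σ ν : gradedAut 𝒜) (r : A ⊗[K] Aᵐᵒᵖ) :
    envMap σ.1 ν.1 (envMap (σ⁻¹).1 (ν⁻¹).1 r) = r := by
  rw [envMap_envMap]
  refine Eq.trans ?_ (envMap_one_one r)
  congr 2
  · exact mul_inv_cancel σ.1
  · exact mul_inv_cancel ν.1

theorem envMap_inv_envMap {ι : Type*} {𝒜 : ι → Submodule K A} (σ ν : gradedAut 𝒜) (r : A ⊗[K] Aᵐᵒᵖ) :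
    envMap (σ⁻¹).1 (ν⁻¹).1 (envMap σ.1 ν.1 r) = r := by
  simpa only [inv_inv] using envMap_envMap_inv σ⁻¹ ν⁻¹ r

/-- An additive map that commutes with the elements `a ⊗ bᵒ` is `Aᵉ`-linear. -/
def envLinearMap {M N : Type*} [AddCommGroup M] [AddCommGroup N] [Module (A ⊗[K] Aᵐᵒᵖ) M]
    [Module (A ⊗[K] Aᵐᵒᵖ) N] (f : M →+ N)
    (hf : ∀ (a b : A) (m : M), f (a ⊗ₜ[K] MulOpposite.op b • m) =
      a ⊗ₜ[K] MulOpposite.op b • f m) : M →ₗ[A ⊗[K] Aᵐᵒᵖ] N :=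
  { f with
    map_smul' := fun r m => by
      change f (r • m) = r • f m
      induction r using env_induction with
      | h0 =>
        exact (congrArg f (zero_smul (A ⊗[K] Aᵐᵒᵖ) m)).trans
          ((map_zero f).trans (zero_smul (A ⊗[K] Aᵐᵒᵖ) (f m)).symm)
      | hadd x y hx hy => rw [add_smul, add_smul, map_add, hx, hy]
      | htmul a b => exact hf a b m }

variable {G : Type uG} [AddCommGroup G] [DecidableEq G] {𝒜 : G → Submodule K A}

/-- The functor `M ↦ Σ_γ ^σ M ^ν`. -/
noncomputable def twistShift (γ : G) (σ ν : gradedAut 𝒜) :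
    GrMod.{v} (envGrading 𝒜) ⥤ GrMod.{v} (envGrading 𝒜) where
  obj M := GrMod.shift γ (twist σ ν M)
  map {M N} f := GrMod.mkHom (M := GrMod.shift γ (twist σ ν M)) (N := GrMod.shift γ (twist σ ν N))
    { toFun := GrMod.linMap f
      map_add' := map_add (GrMod.linMap f)
      map_smul' := fun r m => (GrMod.linMap f).map_smul (envMap σ.1 ν.1 r) m }
    fun _ _ h => GrMod.linMap_mem f h

instance (γ : G) (σ ν : gradedAut 𝒜) :
    (twistShift γ σ ν : GrMod.{v} (envGrading 𝒜) ⥤ _).Additive where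

instance (γ : G) (σ ν : gradedAut 𝒜) :
    (twistShift γ σ ν : GrMod.{v} (envGrading 𝒜) ⥤ _).Faithful where
  map_injective {M N} _ _ h := GrMod.hom_ext' (LinearMap.ext fun m =>
    congrArg (fun t : (twistShift γ σ ν).obj M ⟶ (twistShift γ σ ν).obj N =>
      GrMod.linMap t m) h)

instance (γ : G) (σ ν : gradedAut 𝒜) :
    (twistShift γ σ ν : GrMod.{v} (envGrading 𝒜) ⥤ _).Full where
  map_surjective {M N} f := ⟨GrMod.mkHom (M := M) (N := N)
    { toFun := GrMod.linMap f
      map_add' := map_add (GrMod.linMap f)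
      map_smul' := fun r m => by
        -- Linearity over the twisted structure, applied to the preimage of `r` under `σ ⊗ νᵒ`, is
        -- linearity over the original one.
        have h : GrMod.linMap f (envMap σ.1 ν.1 (envMap (σ⁻¹).1 (ν⁻¹).1 r) • m) =
            envMap σ.1 ν.1 (envMap (σ⁻¹).1 (ν⁻¹).1 r) •
              (show N.carrier from GrMod.linMap f m) :=
          (GrMod.linMap f).map_smul (envMap (σ⁻¹).1 (ν⁻¹).1 r) m
        rwa [envMap_envMap_inv] at h }
    fun δ m h => by
      have hm : m ∈ M.deg (γ + (δ - γ)) := by rwa [add_sub_cancel]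
      have : GrMod.linMap f m ∈ N.deg (γ + (δ - γ)) :=
        GrMod.linMap_mem f (show m ∈ ((twistShift γ σ ν).obj M).deg (δ - γ) from hm)
      rwa [add_sub_cancel] at this, rfl⟩

/-- Untwisting after twisting. -/
noncomputable def twistShiftIso (γ : G) (σ ν : gradedAut 𝒜) (M : GrMod.{v} (envGrading 𝒜)) :
    (twistShift γ σ ν).obj ((twistShift (-γ) σ⁻¹ ν⁻¹).obj M) ≅ M where
  hom := GrMod.mkHom
    (M := (twistShift γ σ ν).obj ((twistShift (-γ) σ⁻¹ ν⁻¹).obj M))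
    { toFun := fun m => m
      map_add' := fun _ _ => rfl
      map_smul' := fun r m => by
        change envMap (σ⁻¹).1 (ν⁻¹).1 (envMap σ.1 ν.1 r) • (show M.carrier from m) =
          r • (show M.carrier from m)
        rw [envMap_inv_envMap] }
    fun δ m h => by
      have : m ∈ M.deg (-γ + (γ + δ)) := h
      rwa [neg_add_cancel_left] at this
  inv := GrMod.mkHom
    (N := (twistShift γ σ ν).obj ((twistShift (-γ) σ⁻¹ ν⁻¹).obj M))
    { toFun := fun m => m
      map_add' := fun _ _ => rfl
      map_smul' := fun r m => by
        change r • (show M.carrier from m) =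
          envMap (σ⁻¹).1 (ν⁻¹).1 (envMap σ.1 ν.1 r) • (show M.carrier from m)
        rw [envMap_inv_envMap] }
    fun δ m h => by
      change m ∈ M.deg (-γ + (γ + δ))
      rwa [neg_add_cancel_left]
  hom_inv_id := rfl
  inv_hom_id := rfl

instance (γ : G) (σ ν : gradedAut 𝒜) :
    (twistShift γ σ ν : GrMod.{v} (envGrading 𝒜) ⥤ _).EssSurj where
  mem_essImage M := ⟨_, ⟨twistShiftIso γ σ ν M⟩⟩

/-- An equivalence preserves finite limits and colimits; this is the exactness that
`Ext.mapExactFunctor` requires. -/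
instance (γ : G) (σ ν : gradedAut 𝒜) :
    (twistShift γ σ ν : GrMod.{v} (envGrading 𝒜) ⥤ _).IsEquivalence where

/-- A morphism from a degree-preserving additive map that commutes with the elements `a ⊗ bᵒ`. -/
noncomputable def envHom {M N : GrMod.{v} (envGrading 𝒜)} (f : M.carrier →+ N.carrier)
    (hf : ∀ (a b : A) (m : M.carrier), f (a ⊗ₜ[K] MulOpposite.op b • m) =
      a ⊗ₜ[K] MulOpposite.op b • f m) (hdeg : ∀ γ, ∀ m ∈ M.deg γ, f m ∈ N.deg γ) : M ⟶ N :=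
  GrMod.mkHom (envLinearMap f hf) hdeg

/-- An element of `M` as an element of `Σ_γ ^σ M ^ν`. -/
noncomputable def toTwist (γ : G) (σ ν : gradedAut 𝒜) (M : GrMod.{v} (envGrading 𝒜)) :
    M.carrier →+ ((twistShift γ σ ν).obj M).carrier := AddMonoidHom.id M.carrier

/-- An element of `Σ_γ ^σ M ^ν` as an element of `M`. -/
noncomputable def ofTwist (γ : G) (σ ν : gradedAut 𝒜) (M : GrMod.{v} (envGrading 𝒜)) :
    ((twistShift γ σ ν).obj M).carrier →+ M.carrier := AddMonoidHom.id M.carrier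

/-- The carrier is unchanged by twisting; `toTwist` and `ofTwist` only record which of the two
actions is meant. -/
theorem smul_toTwist (γ : G) (σ ν : gradedAut 𝒜) (M : GrMod.{v} (envGrading 𝒜))
    (r : A ⊗[K] Aᵐᵒᵖ) (m : M.carrier) :
    r • toTwist γ σ ν M m = toTwist γ σ ν M (envMap σ.1 ν.1 r • m) := rfl

theorem ofTwist_smul (γ : G) (σ ν : gradedAut 𝒜) (M : GrMod.{v} (envGrading 𝒜))
    (r : A ⊗[K] Aᵐᵒᵖ) (m : ((twistShift γ σ ν).obj M).carrier) :
    ofTwist γ σ ν M (r • m) = envMap σ.1 ν.1 r • ofTwist γ σ ν M m := rfl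

theorem toTwist_mem {γ δ ε : G} (h : γ + δ = ε) (σ ν : gradedAut 𝒜) {M : GrMod.{v} (envGrading 𝒜)}
    {m : M.carrier} (hm : m ∈ M.deg ε) :
    toTwist γ σ ν M m ∈ ((twistShift γ σ ν).obj M).deg δ :=
  show m ∈ M.deg (γ + δ) from h ▸ hm

theorem ofTwist_mem {γ δ ε : G} (h : γ + δ = ε) (σ ν : gradedAut 𝒜) {M : GrMod.{v} (envGrading 𝒜)}
    {m : ((twistShift γ σ ν).obj M).carrier} (hm : m ∈ ((twistShift γ σ ν).obj M).deg δ) :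
    ofTwist γ σ ν M m ∈ M.deg ε :=
  h ▸ hm

theorem map_toTwist (γ : G) (σ ν : gradedAut 𝒜) {M N : GrMod.{v} (envGrading 𝒜)}
    (f : M ⟶ N) (m : M.carrier) :
    GrMod.linMap ((twistShift γ σ ν).map f) (toTwist γ σ ν M m) =
      toTwist γ σ ν N (GrMod.linMap f m) := rfl

theorem ofTwist_map (γ : G) (σ ν : gradedAut 𝒜) {M N : GrMod.{v} (envGrading 𝒜)}
    (f : M ⟶ N) (m : ((twistShift γ σ ν).obj M).carrier) :
    ofTwist γ σ ν N (GrMod.linMap ((twistShift γ σ ν).map f) m) =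
      GrMod.linMap f (ofTwist γ σ ν M m) := rfl

/-- The comparison of a product of twists with the composition of twists. -/
noncomputable def twistMulHom {σ τ ρ : gradedAut 𝒜} (h : σ * τ = ρ)
    (M : GrMod.{v} (envGrading 𝒜)) :
    (twistShift 0 ρ ρ).obj M ⟶ (twistShift 0 τ τ).obj ((twistShift 0 σ σ).obj M) :=
  GrMod.mkHom
    { toFun := fun m => toTwist 0 τ τ _ (toTwist 0 σ σ M (ofTwist 0 ρ ρ M m))
      map_add' := fun m n => by rw [map_add, map_add, map_add]
      map_smul' := fun r m => by
        -- In the iterated twist a scalar passes first through the outer `τ`, then through the inner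
        -- `σ`: this fixes the order of the product.
        have hr : envMap ρ.1 ρ.1 r = envMap σ.1 σ.1 (envMap τ.1 τ.1 r) := by
          rw [envMap_envMap, ← h]; rfl
        rw [ofTwist_smul, hr, ← smul_toTwist, ← smul_toTwist, RingHom.id_apply] }
    fun δ m hm => toTwist_mem (zero_add δ) τ τ (toTwist_mem (zero_add δ) σ σ
      (ofTwist_mem (zero_add δ) ρ ρ hm))

theorem linMap_twistMulHom {σ τ ρ : gradedAut 𝒜} (h : σ * τ = ρ)
    (M : GrMod.{v} (envGrading 𝒜)) (m : ((twistShift 0 ρ ρ).obj M).carrier) :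
    GrMod.linMap (twistMulHom h M) m =
      toTwist 0 τ τ _ (toTwist 0 σ σ M (ofTwist 0 ρ ρ M m)) := rfl

end TwistFunctor

/-! ### Reassociating compositions of `Ext` classes with morphisms -/

section ExtComp

universe w v₁ u₁

variable {C : Type u₁} [Category.{v₁} C] [Abelian C] [HasExt.{w} C]

theorem mk₀_comp_comp_mk₀_comp_comp_mk₀ {X X₁ X₂ Y Y₁ Y₂ : C} {n : ℕ} (a : X ⟶ X₁) (b : X₁ ⟶ X₂)
    (y : Ext.{w} X₂ Y₂ n) (c : Y₂ ⟶ Y₁) (e : Y₁ ⟶ Y) :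
    (Ext.mk₀ a).comp (((Ext.mk₀ b).comp (y.comp (Ext.mk₀ c) (add_zero n)) (zero_add n)).comp
      (Ext.mk₀ e) (add_zero n)) (zero_add n) =
      (Ext.mk₀ (a ≫ b)).comp (y.comp (Ext.mk₀ (c ≫ e)) (add_zero n)) (zero_add n) := by
  rw [Ext.comp_assoc_of_third_deg_zero, Ext.comp_assoc_of_third_deg_zero, Ext.mk₀_comp_mk₀,
    Ext.mk₀_comp_mk₀_assoc]

/-- Applies a naturality square in the middle of a composition, in the form that both the
composition law of the action and the skew identity need. -/
theorem mk₀_comp_comp_mk₀_of_comm {X X₁ X₂ Y Y₁ Y₂ : C} {n : ℕ} {y : Ext.{w} X₂ Y₂ n}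
    {y' : Ext.{w} X₁ Y₁ n} {b : X₁ ⟶ X₂} {c : Y₁ ⟶ Y₂} (a : X ⟶ X₁) (e : Y₂ ⟶ Y)
    (h : y'.comp (Ext.mk₀ c) (add_zero n) = (Ext.mk₀ b).comp y (zero_add n)) :
    (Ext.mk₀ (a ≫ b)).comp (y.comp (Ext.mk₀ e) (add_zero n)) (zero_add n) =
      (Ext.mk₀ a).comp (y'.comp (Ext.mk₀ (c ≫ e)) (add_zero n)) (zero_add n) := by
  rw [← Ext.mk₀_comp_mk₀, ← Ext.mk₀_comp_mk₀, ← Ext.comp_assoc_of_third_deg_zero y', h,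
    Ext.comp_assoc_of_second_deg_zero, Ext.comp_assoc_of_third_deg_zero]

end ExtComp

/-! ### The action of graded automorphisms on `uExt^d(A, Aᵉ)` -/

section ExtAction

variable {K : Type uK} [Field K] {A : Type uA} [Ring A] [Algebra K A]
  {G : Type uG} [AddCommGroup G] [DecidableEq G] {𝒜 : G → Submodule K A} [GradedAlgebra 𝒜]

theorem regularBimodule_smul (a b : A) (m : (regularBimodule 𝒜).carrier) :
    (a ⊗ₜ[K] MulOpposite.op b • m : (regularBimodule 𝒜).carrier) =
      (show (regularBimodule 𝒜).carrier from a * ((show A from m) * b)) :=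
  TensorProduct.Algebra.moduleAux_apply a (MulOpposite.op b) (show A from m)

/-- `σ` as an isomorphism of bimodules `A ⟶ ^σ A ^σ`. -/
noncomputable def regularTwist (σ : gradedAut 𝒜) :
    regularBimodule 𝒜 ⟶ (twistShift 0 σ σ).obj (regularBimodule 𝒜) :=
  envHom (M := regularBimodule 𝒜) (N := (twistShift 0 σ σ).obj (regularBimodule 𝒜))
    (σ.1 : A →+ A)
    (fun a b m => by
      refine (congrArg σ.1 (regularBimodule_smul a b m)).trans ?_
      refine Eq.trans ?_ (regularBimodule_smul (𝒜 := 𝒜) (σ.1 a) (σ.1 b) (σ.1 m)).symm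
      exact (map_mul σ.1 _ _).trans (congrArg _ (map_mul σ.1 _ _)))
    fun δ m hm => by
      change σ.1 m ∈ 𝒜 (0 + δ)
      rw [zero_add]
      exact (σ.2 δ m).2 hm

/-- `σ⁻¹ ⊗ (ν⁻¹)ᵒ` as a morphism of bimodules `Σ_γ ^σ (Σ_δ Aᵉ) ^ν ⟶ Σ_{γ + δ} Aᵉ`. -/
noncomputable def envUntwist {γ δ ε : G} (h : γ + δ = ε) (σ ν : gradedAut 𝒜) :
    (twistShift γ σ ν).obj (GrMod.shift δ (GrMod.self (envGrading 𝒜))) ⟶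
      GrMod.shift ε (GrMod.self (envGrading 𝒜)) :=
  GrMod.mkHom (M := (twistShift γ σ ν).obj (GrMod.shift δ (GrMod.self (envGrading 𝒜))))
    (N := GrMod.shift ε (GrMod.self (envGrading 𝒜)))
    { toFun := fun m => envMap (σ⁻¹).1 (ν⁻¹).1 (show A ⊗[K] Aᵐᵒᵖ from m)
      map_add' := fun m n => map_add (envMap (σ⁻¹).1 (ν⁻¹).1) _ _
      map_smul' := fun r m => by
        refine (map_mul (envMap (σ⁻¹).1 (ν⁻¹).1) (envMap σ.1 ν.1 r) _).trans ?_
        rw [envMap_inv_envMap]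
        rfl }
    fun η m hm => by
      have hm' : (show A ⊗[K] Aᵐᵒᵖ from m) ∈ envGrading 𝒜 (δ + (γ + η)) := hm
      rw [← add_assoc, add_comm δ γ, h] at hm'
      exact envMap_mem 𝒜 σ⁻¹ ν⁻¹ hm'

/-- Holds because `σ⁻¹ ⊗ (σ⁻¹)ᵒ` is multiplicative. It carries the twist of right multiplication by
`r` to right multiplication by the image of `r`. -/
theorem map_rmul_comp_envUntwist (σ : gradedAut 𝒜) {γ δ ε : G} (h : γ + δ = ε)
    (r : A ⊗[K] Aᵐᵒᵖ) (hr : r ∈ envGrading 𝒜 γ) :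
    (twistShift 0 σ σ).map (GrMod.rmul h r hr) ≫ envUntwist (zero_add ε) σ σ =
      envUntwist (zero_add δ) σ σ ≫
        GrMod.rmul h (envMap (σ⁻¹).1 (σ⁻¹).1 r) (envMap_mem 𝒜 σ⁻¹ σ⁻¹ hr) :=
  GrMod.hom_ext' (LinearMap.ext fun m =>
    map_mul (envMap (σ⁻¹).1 (σ⁻¹).1) (show A ⊗[K] Aᵐᵒᵖ from m) r)

/-- The natural transformation given by `twistMulHom`. -/
noncomputable def twistShiftMul {σ τ ρ : gradedAut 𝒜} (h : σ * τ = ρ) :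
    (twistShift 0 ρ ρ : GrMod.{v} (envGrading 𝒜) ⥤ _) ⟶
      twistShift 0 σ σ ⋙ twistShift 0 τ τ where
  app M := twistMulHom h M
  naturality M N f := GrMod.hom_ext' (LinearMap.ext fun m => by
    change GrMod.linMap (twistMulHom h N) (GrMod.linMap ((twistShift 0 ρ ρ).map f) m) =
      GrMod.linMap ((twistShift 0 τ τ).map ((twistShift 0 σ σ).map f))
        (GrMod.linMap (twistMulHom h M) m)
    rw [linMap_twistMulHom, linMap_twistMulHom, ofTwist_map, map_toTwist, map_toTwist])

theorem regularTwist_mul {σ τ ρ : gradedAut 𝒜} (h : σ * τ = ρ) :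
    regularTwist τ ≫ (twistShift 0 τ τ).map (regularTwist σ) =
      regularTwist ρ ≫ (twistShiftMul h).app (regularBimodule 𝒜) :=
  GrMod.hom_ext' (LinearMap.ext fun m => by
    change σ.1 (τ.1 m) = ρ.1 m
    rw [← h]
    rfl)

/-- Undoing `σ` and then `τ` undoes `σ τ`. With `regularTwist_mul` this is the coherence at the two
arguments of `Ext` behind `extTwist_extTwist`. -/
theorem envUntwist_mul {σ τ ρ : gradedAut 𝒜} (h : σ * τ = ρ) (δ : G) :
    (twistShiftMul h).app (GrMod.shift δ (GrMod.self (envGrading 𝒜))) ≫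
      (twistShift 0 τ τ).map (envUntwist (zero_add δ) σ σ) ≫ envUntwist (zero_add δ) τ τ =
    envUntwist (zero_add δ) ρ ρ :=
  GrMod.hom_ext' (LinearMap.ext fun m => by
    have hρ : (τ⁻¹).1 * (σ⁻¹).1 = (ρ⁻¹).1 := by rw [← h, mul_inv_rev]; rfl
    refine (envMap_envMap (τ⁻¹).1 (τ⁻¹).1 (σ⁻¹).1 (σ⁻¹).1 (show A ⊗[K] Aᵐᵒᵖ from m)).trans ?_
    rw [hρ]
    rfl)

/-- The action of `σ⁻¹` on `Ext^d(A, Σ_δ Aᵉ)`. -/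
noncomputable def extTwist (σ : gradedAut 𝒜) {d : ℕ} {δ : G}
    (x : Ext.{max (uA + 1) uG} (regularBimodule 𝒜)
      (GrMod.shift δ (GrMod.self (envGrading 𝒜))) d) :
    Ext.{max (uA + 1) uG} (regularBimodule 𝒜)
      (GrMod.shift δ (GrMod.self (envGrading 𝒜))) d :=
  (Ext.mk₀ (regularTwist σ)).comp
    ((x.mapExactFunctor (twistShift 0 σ σ) : Ext.{max (uA + 1) uG} _ _ d).comp
      (Ext.mk₀ (envUntwist (zero_add δ) σ σ)) (add_zero d)) (zero_add d)

theorem extTwist_add (σ : gradedAut 𝒜) {d : ℕ} {δ : G}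
    (x y : Ext.{max (uA + 1) uG} (regularBimodule 𝒜)
      (GrMod.shift δ (GrMod.self (envGrading 𝒜))) d) :
    extTwist σ (x + y) = extTwist σ x + extTwist σ y := by
  simp only [extTwist, Ext.mapExactFunctor_add, Ext.add_comp, Ext.comp_add]

theorem extTwist_extSMul (σ : gradedAut 𝒜) {d : ℕ} {γ δ ε : G} (h : γ + δ = ε)
    (r : envGrading 𝒜 γ)
    (x : Ext.{max (uA + 1) uG} (regularBimodule 𝒜)
      (GrMod.shift δ (GrMod.self (envGrading 𝒜))) d) :
    extTwist σ (extSMul 𝒜 (regularBimodule 𝒜) d h r x) =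
      extSMul 𝒜 (regularBimodule 𝒜) d h
        ⟨envMap (σ⁻¹).1 (σ⁻¹).1 r.1, envMap_mem 𝒜 σ⁻¹ σ⁻¹ r.2⟩ (extTwist σ x) := by
  simp only [extTwist, extSMul, Ext.mapExactFunctor_comp, Ext.mapExactFunctor_mk₀,
    Ext.comp_assoc_of_third_deg_zero, Ext.mk₀_comp_mk₀, map_rmul_comp_envUntwist,
    envFlip_envMap]

/-- Twisting by `σ` and then by `τ` is naturally isomorphic to twisting by `σ τ`, so naturality on
`Ext` reduces the claim to the coherence at both arguments. The order is reversed because `extTwist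
σ` is the action of `σ⁻¹`. -/
theorem extTwist_extTwist {σ τ ρ : gradedAut 𝒜} (hρ : σ * τ = ρ) {d : ℕ} {δ : G}
    (x : Ext.{max (uA + 1) uG} (regularBimodule 𝒜)
      (GrMod.shift δ (GrMod.self (envGrading 𝒜))) d) :
    extTwist τ (extTwist σ x) = extTwist ρ x := by
  have h := mapExactFunctor_naturality.{max (uA + 1) uG, max (uA + 1) uG}
    (twistShiftMul hρ) x
  simp only [extTwist, Ext.mapExactFunctor_comp, Ext.mapExactFunctor_mk₀]
  rw [mapExactFunctor_mapExactFunctor.{max (uA + 1) uG, max (uA + 1) uG, max (uA + 1) uG},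
    ← envUntwist_mul hρ δ]
  refine (mk₀_comp_comp_mk₀_comp_comp_mk₀ _ _ _ _ _).trans ?_
  rw [regularTwist_mul hρ]
  exact mk₀_comp_comp_mk₀_of_comm _ _ h

end ExtAction

/-! ### Skew elements and the action on `uExt^d(A, Aᵉ)` -/

section SkewAction

variable {K : Type uK} [Field K] {A : Type uA} [Ring A] [Algebra K A]

theorem inv_apply_of_isSkew {ι : Type*} {𝒜 : ι → Submodule K A} {σ : gradedAut 𝒜} {z : A}
    (h : IsSkew σ.1 z) : (σ⁻¹).1 z = z :=
  (congrArg (σ⁻¹).1 h.2.symm).trans (σ.1.symm_apply_apply z)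

theorem isSkew_one_one {ι : Type*} (𝒜 : ι → Submodule K A) : IsSkew (1 : gradedAut 𝒜).1 (1 : A) :=
  ⟨fun a => (one_mul a).trans (mul_one a).symm, rfl⟩

variable {G : Type uG} [AddCommGroup G] [DecidableEq G] {𝒜 : G → Submodule K A} [GradedAlgebra 𝒜]
  {σ : gradedAut 𝒜} {z : A} {γ : G}

/-- Left multiplication by a `σ`-skew element, as a transformation `M ⟶ Σ_γ ^σ M`. -/
noncomputable def skewLeft (hz : z ∈ 𝒜 γ) (h : IsSkew σ.1 z) :
    𝟭 (GrMod.{v} (envGrading 𝒜)) ⟶ twistShift γ σ 1 where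
  app M := envHom (M := M) (N := (twistShift γ σ 1).obj M)
    ((toTwist γ σ 1 M).comp
      (DistribSMul.toAddMonoidHom M.carrier (z ⊗ₜ[K] MulOpposite.op (1 : A))))
    (fun a b m => by
      change toTwist γ σ 1 M ((z ⊗ₜ[K] MulOpposite.op (1 : A)) • (a ⊗ₜ[K] MulOpposite.op b) • m) =
        (a ⊗ₜ[K] MulOpposite.op b) • toTwist γ σ 1 M ((z ⊗ₜ[K] MulOpposite.op (1 : A)) • m)
      rw [smul_toTwist, smul_smul, smul_smul, envMap_tmul, Algebra.TensorProduct.tmul_mul_tmul,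
        Algebra.TensorProduct.tmul_mul_tmul, h.1, MulOpposite.op_one, one_mul, mul_one]
      rfl)
    fun δ m hm => toTwist_mem rfl σ 1 (M.smul_mem γ δ _ m
      (tmul_mem_envGrading 𝒜 (add_zero γ) hz SetLike.GradedOne.one_mem) hm)
  naturality M N f := GrMod.hom_ext' (LinearMap.ext fun m =>
    ((GrMod.linMap f).map_smul (z ⊗ₜ[K] MulOpposite.op (1 : A)) m).symm)

/-- Right multiplication by a `σ`-skew element, as a transformation `^σ M ^σ ⟶ Σ_γ ^σ M`. -/
noncomputable def skewRight (hz : z ∈ 𝒜 γ) (h : IsSkew σ.1 z) :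
    (twistShift 0 σ σ : GrMod.{v} (envGrading 𝒜) ⥤ _) ⟶ twistShift γ σ 1 where
  app M := envHom (M := (twistShift 0 σ σ).obj M) (N := (twistShift γ σ 1).obj M)
    (((toTwist γ σ 1 M).comp
      (DistribSMul.toAddMonoidHom M.carrier ((1 : A) ⊗ₜ[K] MulOpposite.op z))).comp
        (ofTwist 0 σ σ M))
    (fun a b m => by
      change toTwist γ σ 1 M (((1 : A) ⊗ₜ[K] MulOpposite.op z) •
          ofTwist 0 σ σ M ((a ⊗ₜ[K] MulOpposite.op b) • m)) =
        (a ⊗ₜ[K] MulOpposite.op b) •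
          toTwist γ σ 1 M (((1 : A) ⊗ₜ[K] MulOpposite.op z) • ofTwist 0 σ σ M m)
      rw [smul_toTwist, ofTwist_smul, smul_smul, smul_smul, envMap_tmul, envMap_tmul,
        Algebra.TensorProduct.tmul_mul_tmul, Algebra.TensorProduct.tmul_mul_tmul,
        ← MulOpposite.op_mul, ← MulOpposite.op_mul, ← h.1, one_mul, mul_one]
      rfl)
    fun δ m hm => toTwist_mem rfl σ 1 (M.smul_mem γ δ _ _
      (tmul_mem_envGrading 𝒜 (zero_add γ) SetLike.GradedOne.one_mem hz)
      (ofTwist_mem (zero_add δ) σ σ hm))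
  naturality M N f := GrMod.hom_ext' (LinearMap.ext fun m =>
    ((GrMod.linMap f).map_smul ((1 : A) ⊗ₜ[K] MulOpposite.op z) (ofTwist 0 σ σ M m)).symm)

/-- This is `z a = σ(a) z`, read as an equality of bimodule maps out of `A`. -/
theorem skewLeft_regularBimodule (hz : z ∈ 𝒜 γ) (h : IsSkew σ.1 z) :
    (skewLeft hz h).app (regularBimodule 𝒜) =
      regularTwist σ ≫ (skewRight hz h).app (regularBimodule 𝒜) :=
  GrMod.hom_ext' (LinearMap.ext fun m => by
    refine (regularBimodule_smul z 1 m).trans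
      (Eq.trans ?_ (regularBimodule_smul (𝒜 := 𝒜) 1 z (σ.1 m)).symm)
    change z * ((show A from m) * 1) = 1 * (σ.1 m * z)
    rw [mul_one, one_mul, h.1])

/-- Here `σ(z) = z` enters: `σ⁻¹(z a) = σ⁻¹(σ(a) z) = a z`, so untwisting turns left multiplication
by `z` in the first factor into right multiplication. -/
theorem skewLeft_comp_envUntwist (hz : z ∈ 𝒜 γ) (h : IsSkew σ.1 z) {δ ε : G} (hε : γ + δ = ε) :
    (skewLeft hz h).app (GrMod.shift δ (GrMod.self (envGrading 𝒜))) ≫ envUntwist hε σ 1 =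
      GrMod.rmul hε (z ⊗ₜ[K] MulOpposite.op (1 : A))
        (tmul_mem_envGrading 𝒜 (add_zero γ) hz SetLike.GradedOne.one_mem) :=
  GrMod.hom_ext' (LinearMap.ext fun m => by
    change envMap (σ⁻¹).1 ((1 : gradedAut 𝒜)⁻¹).1 ((z ⊗ₜ[K] MulOpposite.op (1 : A)) *
      (show A ⊗[K] Aᵐᵒᵖ from m)) = (show A ⊗[K] Aᵐᵒᵖ from m) * (z ⊗ₜ[K] MulOpposite.op (1 : A))
    generalize (show A ⊗[K] Aᵐᵒᵖ from m) = t
    induction t using env_induction with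
    | h0 => simp
    | hadd x y hx hy => rw [mul_add, map_add, hx, hy, add_mul]
    | htmul a b =>
      rw [Algebra.TensorProduct.tmul_mul_tmul, Algebra.TensorProduct.tmul_mul_tmul, h.1,
        MulOpposite.op_one, one_mul, mul_one, envMap_tmul, map_mul, inv_apply_of_isSkew h,
        inv_one]
      exact congrArg (fun c => (c * z) ⊗ₜ[K] MulOpposite.op b) (σ.1.symm_apply_apply a))

/-- In the second factor this is `b z = z σ⁻¹(b)`. -/
theorem skewRight_comp_envUntwist (hz : z ∈ 𝒜 γ) (h : IsSkew σ.1 z) {δ ε : G}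
    (hε : γ + δ = ε) :
    (skewRight hz h).app (GrMod.shift δ (GrMod.self (envGrading 𝒜))) ≫ envUntwist hε σ 1 =
      envUntwist (zero_add δ) σ σ ≫ GrMod.rmul hε ((1 : A) ⊗ₜ[K] MulOpposite.op z)
        (tmul_mem_envGrading 𝒜 (zero_add γ) SetLike.GradedOne.one_mem hz) :=
  GrMod.hom_ext' (LinearMap.ext fun m => by
    change envMap (σ⁻¹).1 ((1 : gradedAut 𝒜)⁻¹).1 (((1 : A) ⊗ₜ[K] MulOpposite.op z) *
      (show A ⊗[K] Aᵐᵒᵖ from m)) =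
        envMap (σ⁻¹).1 (σ⁻¹).1 (show A ⊗[K] Aᵐᵒᵖ from m) * ((1 : A) ⊗ₜ[K] MulOpposite.op z)
    generalize (show A ⊗[K] Aᵐᵒᵖ from m) = t
    induction t using env_induction with
    | h0 => simp
    | hadd x y hx hy => rw [mul_add, map_add, hx, hy, map_add, add_mul]
    | htmul a b =>
      have hb : z * (σ⁻¹).1 b = b * z :=
        (h.1 _).trans (congrArg (· * z) (σ.1.apply_symm_apply b))
      rw [Algebra.TensorProduct.tmul_mul_tmul, envMap_tmul, Algebra.TensorProduct.tmul_mul_tmul,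
        ← MulOpposite.op_mul, ← MulOpposite.op_mul, hb, one_mul, mul_one, inv_one]
      rfl)

/-- This is `x z = z Φ_σ(x)`. The right action of `z` is composition with `skewLeft` at `Aᵉ`
followed by untwisting. Naturality moves `skewLeft` to `A`, where it factors as `σ` followed by
`skewRight`; naturality then moves `skewRight` back to `Aᵉ`, where it gives the left action. -/
theorem extSMul_eq_extSMul_extTwist (hz : z ∈ 𝒜 γ) (h : IsSkew σ.1 z) {d : ℕ} {δ ε : G}
    (hε : γ + δ = ε) (x : Ext.{max (uA + 1) uG} (regularBimodule 𝒜)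
      (GrMod.shift δ (GrMod.self (envGrading 𝒜))) d) :
    extSMul 𝒜 (regularBimodule 𝒜) d hε ⟨(1 : A) ⊗ₜ[K] MulOpposite.op z,
        tmul_mem_envGrading 𝒜 (zero_add γ) SetLike.GradedOne.one_mem hz⟩ x =
      extSMul 𝒜 (regularBimodule 𝒜) d hε ⟨z ⊗ₜ[K] MulOpposite.op (1 : A),
        tmul_mem_envGrading 𝒜 (add_zero γ) hz SetLike.GradedOne.one_mem⟩ (extTwist σ x) := by
  have h₁ := mapExactFunctor_naturality.{max (uA + 1) uG, max (uA + 1) uG} (skewLeft hz h) x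
  have h₂ := mapExactFunctor_naturality.{max (uA + 1) uG, max (uA + 1) uG} (skewRight hz h) x
  rw [mapExactFunctor_id] at h₁
  simp only [extSMul, envFlip_tmul, extTwist]
  rw [← skewLeft_comp_envUntwist hz h hε, Ext.comp_assoc_of_third_deg_zero,
    Ext.comp_assoc_of_third_deg_zero, Ext.mk₀_comp_mk₀, ← skewRight_comp_envUntwist hz h hε]
  refine Eq.trans ?_ (mk₀_comp_comp_mk₀_of_comm (regularTwist σ) (envUntwist hε σ 1) h₂)
  rw [← skewLeft_regularBimodule, ← Ext.comp_assoc_of_third_deg_zero, ← h₁,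
    Ext.comp_assoc_of_third_deg_zero, Ext.mk₀_comp_mk₀]

/-- The unit `1` is skew for the identity, and the skew identity for it is the claim. -/
theorem extTwist_one {d : ℕ} {δ : G} (x : Ext.{max (uA + 1) uG} (regularBimodule 𝒜)
    (GrMod.shift δ (GrMod.self (envGrading 𝒜))) d) : extTwist 1 x = x := by
  have := extSMul_eq_extSMul_extTwist SetLike.GradedOne.one_mem (isSkew_one_one 𝒜) (zero_add δ) x
  exact (extSMul_one 𝒜 (regularBimodule 𝒜) d (extTwist 1 x)).symm.trans
    (this.symm.trans (extSMul_one 𝒜 (regularBimodule 𝒜) d x))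

end SkewAction

/-! ### The action on the total space `uExt^d(A, Aᵉ)` -/

section UExtAction

variable {K : Type uK} [Field K] {A : Type uA} [Ring A] [Algebra K A]
  {G : Type uG} [AddCommGroup G] [DecidableEq G] {𝒜 : G → Submodule K A} [GradedAlgebra 𝒜]
  {d : ℕ}

/-- An `Ext` class as an element of `uExt^d(A, Aᵉ)`. -/
noncomputable def uExtOf (𝒜 : G → Submodule K A) [GradedAlgebra 𝒜] (d : ℕ) (γ : G) :
    extComponent 𝒜 (regularBimodule 𝒜) d γ →+ (uExt 𝒜 (regularBimodule 𝒜) d).carrier :=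
  DirectSum.of (extComponent 𝒜 (regularBimodule 𝒜) d) γ

theorem uExt_induction {p : (uExt 𝒜 (regularBimodule 𝒜) d).carrier → Prop} (h0 : p 0)
    (hof : ∀ γ x, p (uExtOf 𝒜 d γ x)) (hadd : ∀ x y, p x → p y → p (x + y))
    (m : (uExt 𝒜 (regularBimodule 𝒜) d).carrier) : p m :=
  DirectSum.induction_on (motive := p) m h0 hof hadd

theorem smul_uExtOf {γ δ : G} (r : envGrading 𝒜 γ)
    (x : extComponent 𝒜 (regularBimodule 𝒜) d δ) :
    (r : A ⊗[K] Aᵐᵒᵖ) • uExtOf 𝒜 d δ x =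
      uExtOf 𝒜 d (γ + δ) (extSMul 𝒜 (regularBimodule 𝒜) d rfl r x) := by
  change DirectSum.decompose (envGrading 𝒜) (r : A ⊗[K] Aᵐᵒᵖ) •
    DirectSum.of (extComponent 𝒜 (regularBimodule 𝒜) d) δ x = _
  rw [DirectSum.decompose_coe, DirectSum.Gmodule.of_smul_of]
  rfl

/-- The action of `σ⁻¹` on the components of `uExt^d(A, Aᵉ)`. -/
noncomputable def extComponentTwist (d : ℕ) (σ : gradedAut 𝒜) (γ : G) :
    extComponent 𝒜 (regularBimodule 𝒜) d γ →+ extComponent 𝒜 (regularBimodule 𝒜) d γ :=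
  AddMonoidHom.mk' (fun x => extTwist σ x) (extTwist_add σ)

/-- The action of `σ⁻¹` on `uExt^d(A, Aᵉ)`. -/
noncomputable def uExtTwist (d : ℕ) (σ : gradedAut 𝒜) :
    (uExt 𝒜 (regularBimodule 𝒜) d).carrier →+ (uExt 𝒜 (regularBimodule 𝒜) d).carrier :=
  DirectSum.map (α := extComponent 𝒜 (regularBimodule 𝒜) d)
    (β := extComponent 𝒜 (regularBimodule 𝒜) d)
    (extComponentTwist d σ)

theorem uExtTwist_of (σ : gradedAut 𝒜) (γ : G) (x : extComponent 𝒜 (regularBimodule 𝒜) d γ) :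
    uExtTwist d σ (uExtOf 𝒜 d γ x) = uExtOf 𝒜 d γ (extComponentTwist d σ γ x) :=
  DirectSum.map_of _ _ _

theorem uExtTwist_one (m : (uExt 𝒜 (regularBimodule 𝒜) d).carrier) : uExtTwist d 1 m = m := by
  induction m using uExt_induction with
  | h0 => exact map_zero _
  | hof γ x => rw [uExtTwist_of]; exact congrArg _ (extTwist_one x)
  | hadd x y hx hy => rw [map_add, hx, hy]

theorem uExtTwist_uExtTwist (σ τ : gradedAut 𝒜) (m : (uExt 𝒜 (regularBimodule 𝒜) d).carrier) :
    uExtTwist d τ (uExtTwist d σ m) = uExtTwist d (σ * τ) m := by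
  induction m using uExt_induction with
  | h0 => simp only [map_zero]
  | hof γ x =>
    rw [uExtTwist_of, uExtTwist_of, uExtTwist_of]
    exact congrArg _ (extTwist_extTwist rfl x)
  | hadd x y hx hy => rw [map_add, map_add, hx, hy, map_add]

theorem uExtTwist_mem (σ : gradedAut 𝒜) {γ : G} {m : (uExt 𝒜 (regularBimodule 𝒜) d).carrier}
    (hm : m ∈ (uExt 𝒜 (regularBimodule 𝒜) d).deg γ) :
    uExtTwist d σ m ∈ (uExt 𝒜 (regularBimodule 𝒜) d).deg γ := by
  obtain ⟨x, rfl⟩ := hm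
  exact ⟨extComponentTwist d σ γ x, (uExtTwist_of σ γ x).symm⟩

theorem uExtTwist_smul (σ : gradedAut 𝒜) (r : A ⊗[K] Aᵐᵒᵖ)
    (m : (uExt 𝒜 (regularBimodule 𝒜) d).carrier) :
    uExtTwist d σ (r • m) = envMap (σ⁻¹).1 (σ⁻¹).1 r • uExtTwist d σ m := by
  induction m using uExt_induction with
  | h0 => rw [smul_zero, map_zero, smul_zero]
  | hadd x y hx hy => rw [smul_add, map_add, hx, hy, map_add, smul_add]
  | hof δ x =>
    induction r using DirectSum.Decomposition.inductionOn (envGrading 𝒜) with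
    | zero =>
      rw [map_zero (envMap _ _)]
      exact (congrArg (uExtTwist d σ) (zero_smul (A ⊗[K] Aᵐᵒᵖ) _)).trans
        ((map_zero _).trans
          (zero_smul (A ⊗[K] Aᵐᵒᵖ) (uExtTwist d σ (uExtOf 𝒜 d δ x))).symm)
    | add r s hr hs => rw [add_smul, map_add, hr, hs, map_add, add_smul]
    | homogeneous r =>
      rw [smul_uExtOf, uExtTwist_of σ δ x]
      exact (uExtTwist_of σ _ _).trans <| (congrArg _ (extTwist_extSMul σ rfl r x)).trans
        (smul_uExtOf ⟨_, envMap_mem 𝒜 σ⁻¹ σ⁻¹ r.2⟩ (extComponentTwist d σ δ x)).symm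

theorem decompose_gradedAut_apply (σ : gradedAut 𝒜) (z : A) (γ : G) :
    (DirectSum.decompose 𝒜 (σ.1 z) γ : A) = σ.1 (DirectSum.decompose 𝒜 z γ) := by
  induction z using DirectSum.Decomposition.inductionOn 𝒜 with
  | zero => simp
  | add x y hx hy => simp [hx, hy]
  | @homogeneous δ z =>
    have hz := (σ.2 δ z).2 z.2
    by_cases h : δ = γ
    · subst h
      rw [DirectSum.decompose_of_mem_same 𝒜 hz, DirectSum.decompose_of_mem_same 𝒜 z.2]
    · rw [DirectSum.decompose_of_mem_ne 𝒜 hz h, DirectSum.decompose_of_mem_ne 𝒜 z.2 h, map_zero]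

/-- Since `σ` preserves degrees, both conditions can be compared degree by degree; this reduces
arbitrary skew elements to homogeneous ones. -/
theorem isSkew_decompose {σ : gradedAut 𝒜} {z : A} (h : IsSkew σ.1 z) (γ : G) :
    IsSkew σ.1 (DirectSum.decompose 𝒜 z γ : A) := by
  refine ⟨fun a => ?_, by rw [← decompose_gradedAut_apply, h.2]⟩
  induction a using DirectSum.Decomposition.inductionOn 𝒜 with
  | zero => simp
  | add x y hx hy => rw [mul_add, hx, hy, map_add, add_mul]
  | @homogeneous δ a =>
    -- Both sides are the component of degree `γ + δ` of `z a = σ(a) z`.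
    rw [← DirectSum.coe_decompose_mul_add_of_right_mem 𝒜 a.2,
      ← DirectSum.coe_decompose_mul_add_of_left_mem 𝒜 ((σ.2 δ a).2 a.2), h.1, add_comm]

theorem smul_eq_smul_uExtTwist {σ : gradedAut 𝒜} {z : A} (h : IsSkew σ.1 z)
    (m : (uExt 𝒜 (regularBimodule 𝒜) d).carrier) :
    ((1 : A) ⊗ₜ[K] MulOpposite.op z) • m =
      (z ⊗ₜ[K] MulOpposite.op (1 : A)) • uExtTwist d σ m := by
  have key : ∀ γ, ∀ w ∈ 𝒜 γ, IsSkew σ.1 w → ((1 : A) ⊗ₜ[K] MulOpposite.op w) • m =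
      (w ⊗ₜ[K] MulOpposite.op (1 : A)) • uExtTwist d σ m := by
    intro γ w hw hs
    induction m using uExt_induction with
    | h0 => rw [smul_zero, map_zero, smul_zero]
    | hadd x y hx hy => rw [smul_add, hx, hy, map_add, smul_add]
    | hof δ x =>
      rw [uExtTwist_of]
      refine (smul_uExtOf ⟨_, tmul_mem_envGrading 𝒜 (zero_add γ) SetLike.GradedOne.one_mem hw⟩
        x).trans (Eq.trans ?_ (smul_uExtOf ⟨_, tmul_mem_envGrading 𝒜 (add_zero γ) hw
          SetLike.GradedOne.one_mem⟩ (extComponentTwist d σ δ x)).symm)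
      exact congrArg _ (extSMul_eq_extSMul_extTwist hw hs rfl x)
  classical
  rw [← DirectSum.sum_support_decompose 𝒜 z, Finset.op_sum, TensorProduct.tmul_sum,
    TensorProduct.sum_tmul, Finset.sum_smul, Finset.sum_smul]
  exact Finset.sum_congr rfl fun γ _ => key γ _ (Subtype.coe_prop _) (isSkew_decompose h γ)

end UExtAction

/-! ### The Nakayama automorphism -/

section Nakayama

variable {K : Type uK} [Field K] {A : Type uA} [Ring A] [Algebra K A]
  {G : Type uG} [AddCommGroup G] [DecidableEq G] {𝒜 : G → Submodule K A} [GradedAlgebra 𝒜]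

/-- Transports the action on `uExt^d(A, Aᵉ)` to `A` along the given isomorphism. What remains is a
statement about additive maps of `A`, with no `Ext` in it. -/
theorem exists_twisted_action {d : ℕ} {μ : gradedAut 𝒜} {l : G}
    (h : GrMod.GradedIso (uExt 𝒜 (regularBimodule 𝒜) d)
      (GrMod.shift l (twist 1 μ (regularBimodule 𝒜)))) :
    ∃ Φ : gradedAut 𝒜 → A →+ A, (∀ m, Φ 1 m = m) ∧
      (∀ σ τ m, Φ τ (Φ σ m) = Φ (σ * τ) m) ∧
      (∀ σ a m b, Φ σ (a * (m * μ.1 b)) = (σ⁻¹).1 a * (Φ σ m * μ.1 ((σ⁻¹).1 b))) ∧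
      (∀ σ, ∀ m ∈ 𝒜 0, Φ σ m ∈ 𝒜 0) ∧
      (∀ (σ : gradedAut 𝒜) (z : A), IsSkew σ.1 z → ∀ m, m * μ.1 z = z * Φ σ m) := by
  obtain ⟨e, he⟩ := h
  have hsmul (a b : A) (m : (GrMod.shift l (twist 1 μ (regularBimodule 𝒜))).carrier) :
      (a ⊗ₜ[K] MulOpposite.op b) • m =
        (show (GrMod.shift l (twist 1 μ (regularBimodule 𝒜))).carrier from
          a * ((show A from m) * μ.1 b)) :=
    regularBimodule_smul (𝒜 := 𝒜) a (μ.1 b) m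
  let Φ : gradedAut 𝒜 → A →+ A := fun σ =>
    (e.toAddEquiv.toAddMonoidHom.comp (uExtTwist d σ)).comp e.symm.toAddEquiv.toAddMonoidHom
  have hΦ (σ : gradedAut 𝒜) (m : (uExt 𝒜 (regularBimodule 𝒜) d).carrier) :
      Φ σ (e m) = e (uExtTwist d σ m) :=
    congrArg (fun t => e (uExtTwist d σ t)) (e.symm_apply_apply m)
  refine ⟨Φ, fun m => ?_, fun σ τ m => ?_, fun σ a m b => ?_, fun σ m hm => ?_,
    fun σ z hz m => ?_⟩
  · obtain ⟨m, rfl⟩ := e.surjective m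
    rw [hΦ, uExtTwist_one]
  · obtain ⟨m, rfl⟩ := e.surjective m
    rw [hΦ, hΦ, hΦ, uExtTwist_uExtTwist]
  · obtain ⟨m, rfl⟩ := e.surjective m
    rw [hΦ]
    refine Eq.trans ?_ (hsmul ((σ⁻¹).1 a) ((σ⁻¹).1 b) (e (uExtTwist d σ m)))
    refine (congrArg (Φ σ) ((hsmul a b (e m)).symm.trans (map_smul e _ m).symm)).trans ?_
    rw [hΦ, uExtTwist_smul]
    exact map_smul e _ _
  · obtain ⟨m, rfl⟩ := e.surjective m
    rw [hΦ]
    -- `A_0` is the component of degree `-l` of the shift by `l`, and the action preserves that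
    -- component.
    have hdeg (n : (uExt 𝒜 (regularBimodule 𝒜) d).carrier) :
        (show A from e n) ∈ 𝒜 0 ↔ n ∈ (uExt 𝒜 (regularBimodule 𝒜) d).deg (-l) := by
      rw [← he]
      change _ ↔ (show A from e n) ∈ 𝒜 (l + -l)
      rw [add_neg_cancel]
    exact (hdeg _).2 (uExtTwist_mem σ ((hdeg m).1 hm))
  · obtain ⟨m, rfl⟩ := e.surjective m
    rw [hΦ]
    have h₁ := congrArg e (smul_eq_smul_uExtTwist hz m)
    rw [map_smul, map_smul] at h₁
    have h₂ : 1 * ((show A from e m) * μ.1 z) =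
        z * ((show A from e (uExtTwist d σ m)) * μ.1 1) :=
      (hsmul 1 z (e m)).symm.trans (h₁.trans (hsmul z 1 (e (uExtTwist d σ m))))
    rwa [one_mul, map_one, mul_one] at h₂

theorem exists_cocycle (μ : gradedAut 𝒜) {Φ : gradedAut 𝒜 → A →+ A} (hone : ∀ m, Φ 1 m = m)
    (hmul : ∀ σ τ m, Φ τ (Φ σ m) = Φ (σ * τ) m)
    (hsmul : ∀ σ a m b, Φ σ (a * (m * μ.1 b)) = (σ⁻¹).1 a * (Φ σ m * μ.1 ((σ⁻¹).1 b)))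
    (hdeg : ∀ σ, ∀ m ∈ 𝒜 0, Φ σ m ∈ 𝒜 0)
    (hskew : ∀ (σ : gradedAut 𝒜) (z : A), IsSkew σ.1 z → ∀ m, m * μ.1 z = z * Φ σ m) :
    ∃ Ξ : gradedAut 𝒜 → (𝒜 0)ˣ,
      (∀ σ τ : gradedAut 𝒜,
        ((Ξ (σ * τ) : 𝒜 0) : A) = ((Ξ σ : 𝒜 0) : A) * σ.1 ((Ξ τ : 𝒜 0) : A)) ∧
      (∀ σ : gradedAut 𝒜, μ * σ * μ⁻¹ * σ⁻¹ = innerAut 𝒜 (Ξ σ)) ∧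
      (∀ (σ : gradedAut 𝒜) (z : A), IsSkew σ.1 z → μ.1 z = ((Ξ σ : 𝒜 0) : A) * z) := by
  have hinv (σ : gradedAut 𝒜) (a : A) : (σ⁻¹).1 (σ.1 a) = a := σ.1.symm_apply_apply a
  have hinv' (σ : gradedAut 𝒜) (a : A) : σ.1 ((σ⁻¹).1 a) = a := σ.1.apply_symm_apply a
  have hleft (σ : gradedAut 𝒜) (a : A) : Φ σ a = (σ⁻¹).1 a * Φ σ 1 := by
    simpa using hsmul σ a 1 1
  have hright (σ : gradedAut 𝒜) (b : A) : Φ σ (μ.1 b) = Φ σ 1 * μ.1 ((σ⁻¹).1 b) := by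
    simpa using hsmul σ 1 1 b
  -- Semilinearity leaves `Φ σ 1` as the only freedom in `Φ σ`; applying `σ` makes it a left factor
  -- and turns the composition law into the cocycle identity.
  let u : gradedAut 𝒜 → A := fun σ => σ.1 (Φ σ 1)
  have hu (σ : gradedAut 𝒜) : u σ ∈ 𝒜 0 := (σ.2 0 _).2 (hdeg σ 1 SetLike.GradedOne.one_mem)
  have hu1 : u 1 = 1 := hone 1
  have humul (σ τ : gradedAut 𝒜) : u (σ * τ) = u σ * σ.1 (u τ) := by
    change σ.1 (τ.1 (Φ (σ * τ) 1)) = σ.1 (Φ σ 1) * σ.1 (τ.1 (Φ τ 1))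
    rw [← hmul, hleft τ (Φ σ 1), map_mul, map_mul, hinv']
  -- The cocycle identity at `σ` and `σ⁻¹` yields the inverse `σ(u(σ⁻¹))`.
  have huinv (σ : gradedAut 𝒜) : u σ * σ.1 (u σ⁻¹) = 1 := by
    rw [← humul, mul_inv_cancel, hu1]
  have huinv' (σ : gradedAut 𝒜) : σ.1 (u σ⁻¹) * u σ = 1 := by
    have h : σ.1 (u σ⁻¹ * (σ⁻¹).1 (u σ)) = σ.1 (u σ⁻¹) * u σ :=
      (map_mul σ.1 _ _).trans (congrArg _ (hinv' σ (u σ)))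
    rw [← h, ← humul, inv_mul_cancel, hu1, map_one]
  let Ξ : gradedAut 𝒜 → (𝒜 0)ˣ := fun σ =>
    { val := ⟨u σ, hu σ⟩
      inv := ⟨σ.1 (u σ⁻¹), (σ.2 0 _).2 (hu σ⁻¹)⟩
      val_inv := Subtype.ext (huinv σ)
      inv_val := Subtype.ext (huinv' σ) }
  refine ⟨Ξ, humul, fun σ => ?_, fun σ z hz => ?_⟩
  · refine Subtype.ext (AlgEquiv.ext fun a => ?_)
    change μ.1 (σ.1 ((μ⁻¹).1 ((σ⁻¹).1 a))) = u σ * a * σ.1 (u σ⁻¹)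
    -- The left and right formulas for `Φ σ (μ b)`, after applying `σ`.
    have hcomm (b : A) : μ.1 b * u σ = u σ * σ.1 (μ.1 ((σ⁻¹).1 b)) := by
      have := congrArg σ.1 ((hleft σ (μ.1 b)).symm.trans (hright σ b))
      rwa [map_mul, map_mul, hinv'] at this
    -- The argument `σ μ⁻¹ σ⁻¹(a)` is chosen so that the right-hand side collapses to `u σ * a`.
    have h := hcomm (σ.1 ((μ⁻¹).1 ((σ⁻¹).1 a)))
    rw [hinv, hinv', hinv'] at h
    rw [← h, mul_assoc, huinv, mul_one]
  · have h := hskew σ z hz 1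
    rwa [one_mul, hz.1] at h

/-- The automorphism `σ` with `z a = σ(a) z`, for a homogeneous regular normal element `z`. -/
theorem exists_isSkew {γ : G} {z : A} (hz : z ∈ 𝒜 γ) (hreg : IsRegular z)
    (hnorm : IsNormalElement z) : ∃ σ : gradedAut 𝒜, IsSkew σ.1 z := by
  have h₁ (a : A) : ∃ b, b * z = z * a := by
    have : z * a ∈ Set.range (fun a : A => a * z) := hnorm ▸ ⟨a, rfl⟩
    exact this
  have h₂ (b : A) : ∃ a, z * a = b * z := by
    have : b * z ∈ Set.range (fun a : A => z * a) := hnorm ▸ ⟨b, rfl⟩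
    exact this
  choose f hf using h₁
  choose g hg using h₂
  -- Normality gives existence of `f a` and `g b`; cancelling the regular element `z` gives every
  -- algebraic identity.
  let σ : A ≃ₐ[K] A :=
    { toFun := f
      invFun := g
      left_inv := fun a => hreg.left ((hg (f a)).trans (hf a))
      right_inv := fun b => hreg.right ((hf (g b)).trans (hg b))
      map_mul' := fun a b => hreg.right (by
        change f (a * b) * z = f a * f b * z
        rw [hf, mul_assoc (f a), hf b, ← mul_assoc (f a), hf a, mul_assoc])
      map_add' := fun a b => hreg.right (by
        change f (a + b) * z = (f a + f b) * z
        rw [hf, add_mul, hf, hf, mul_add])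
      commutes' := fun c => hreg.right (by
        change f (algebraMap K A c) * z = algebraMap K A c * z
        rw [hf, Algebra.commutes]) }
  have hmem {δ : G} {a : A} (ha : a ∈ 𝒜 δ) : f a ∈ 𝒜 δ := by
    -- As `z` is homogeneous, `f(a)_δ z` is the component of degree `δ + γ` of `f(a) z = z a`, which
    -- is all of it; cancel `z`.
    have h : (DirectSum.decompose 𝒜 (f a) δ : A) = f a := hreg.right (by
      change _ * z = _ * z
      rw [← DirectSum.coe_decompose_mul_add_of_right_mem 𝒜 hz, hf, add_comm,
        DirectSum.decompose_of_mem_same 𝒜 (SetLike.mul_mem_graded hz ha)])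
    exact h ▸ Subtype.coe_prop _
  have hmem' {δ : G} {a : A} (ha : f a ∈ 𝒜 δ) : a ∈ 𝒜 δ := by
    have h : (DirectSum.decompose 𝒜 a δ : A) = a := hreg.left (by
      change z * _ = z * _
      rw [← DirectSum.coe_decompose_mul_add_of_left_mem 𝒜 hz, ← hf, add_comm,
        DirectSum.decompose_of_mem_same 𝒜 (SetLike.mul_mem_graded ha hz)])
    exact h ▸ Subtype.coe_prop _
  -- The condition `σ(z) = z` follows by cancelling `z` in `σ(z) z = z z`.
  exact ⟨⟨σ, fun δ a => ⟨hmem', hmem⟩⟩, fun a => (hf a).symm, hreg.right (hf z)⟩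

end Nakayama

theorem mainTheorem3 {K : Type uK} [Field K] {G : Type uG} [AddCommGroup G] [DecidableEq G]
    {A : Type uA} [Ring A] [Algebra K A] (𝒜 : G → Submodule K A) [GradedAlgebra 𝒜]
    (d : ℕ) (μ : gradedAut 𝒜) (l : G)
    (h : GrMod.GradedIso (uExt 𝒜 (regularBimodule 𝒜) d)
      (GrMod.shift l (twist 1 μ (regularBimodule 𝒜)))) :
    (∃ Ξ : gradedAut 𝒜 → (𝒜 0)ˣ,
      (∀ σ τ : gradedAut 𝒜,
        ((Ξ (σ * τ) : 𝒜 0) : A) = ((Ξ σ : 𝒜 0) : A) * σ.1 ((Ξ τ : 𝒜 0) : A)) ∧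
      (∀ σ : gradedAut 𝒜, μ * σ * μ⁻¹ * σ⁻¹ = innerAut 𝒜 (Ξ σ)) ∧
      (∀ (σ : gradedAut 𝒜) (z : A), IsSkew σ.1 z → μ.1 z = ((Ξ σ : 𝒜 0) : A) * z)) ∧
    (∀ (γ : G) (z : A), z ∈ 𝒜 γ → IsRegular z → IsNormalElement z →
      ∃ ξ : (𝒜 0)ˣ, μ.1 z = ((ξ : 𝒜 0) : A) * z) ∧
    (∀ z ∈ Subalgebra.center K A, μ.1 z = z) ∧
    ((∀ ξ : (𝒜 0)ˣ, ((ξ : 𝒜 0) : A) ∈ Subalgebra.center K A) →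
      μ ∈ Subgroup.center (gradedAut 𝒜)) := by
  obtain ⟨Φ, hone, hmul, hsmul, hdeg, hskew⟩ := exists_twisted_action h
  obtain ⟨Ξ, hΞmul, hΞinner, hΞskew⟩ := exists_cocycle μ hone hmul hsmul hdeg hskew
  refine ⟨⟨Ξ, hΞmul, hΞinner, hΞskew⟩, fun γ z hz hreg hnorm => ?_, fun z hz => ?_,
    fun hcentral => Subgroup.mem_center_iff.2 fun σ => ?_⟩
  · obtain ⟨σ, hσ⟩ := exists_isSkew hz hreg hnorm
    exact ⟨Ξ σ, hΞskew σ z hσ⟩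
  · have h₁ := hskew 1 z ⟨fun a => (Subalgebra.mem_center_iff.1 hz a).symm, rfl⟩ 1
    rwa [hone, one_mul, mul_one] at h₁
  · have h₁ : innerAut 𝒜 (Ξ σ) = 1 := by
      refine Subtype.ext (AlgEquiv.ext fun a => ?_)
      change ((Ξ σ : 𝒜 0) : A) * a * (((Ξ σ)⁻¹ : (𝒜 0)ˣ) : 𝒜 0) = a
      rw [← Subalgebra.mem_center_iff.1 (hcentral (Ξ σ)) a, mul_assoc, unit_mul_inv, mul_one]
    have h₂ := hΞinner σ
    rw [h₁, mul_inv_eq_one, mul_inv_eq_iff_eq_mul] at h₂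
    exact h₂.symm
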